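/- Let $b=(\sqrt5-1)/2$ and let $F:\mathbb R\to\mathbb R$ be the piecewise affine "connect-the-dots" map with dots at $(k,k-1)$ and $(k+b,k+b+1)$, $k\in\mathbb Z$ (linear interpolation between consecutive dots). Let $h:(0,1)\to\mathbb R$ be any homeomorphism, let $f:[0,1]\to[0,1]$ be given by $f=h^{-1}\circ F\circ h$ on $(0,1)$ and $f(0)=0$, $f(1)=1$, and let $P=\{0,1\}\cup\{h^{-1}(k),h^{-1}(k+b):k\in\mathbb Z\}$. Definitions. For $-\infty\le\alpha<\beta\le\infty$, a continuous map $g:[\alpha,\beta]\to[\alpha,\beta]$ is *countably piecewise monotone and Markov* with respect to a closed countable set $Q\subset[\alpha,\beta]$ with $\alpha,\beta\in Q$ if $g(Q)\subset Q$ and $g$ is monotone on each $Q$-basic interval, i.e. on each connected component of $[\alpha,\beta]\setminus Q$. It has *constant slope* $\lambda$ if, for some such $Q$, it is moreover affine with slope of absolute value $\lambda$ on each $Q$-basic interval. The transition matrix $T$ of $f$ is indexed by the $P$-basic intervals, with $T(I,J)=1$ if $f(I)\supseteq J$ and $T(I,J)=0$ otherwise. A nonnegative eigenvector of $T$ with eigenvalue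 $\lambda\in\mathbb R$ is a nonzero real vector $v=(v_I)$ with all $v_I\ge0$ and $\sum_J T(I,J)v_J=\lambda v_I$ for every $I$. Then: 1. $F$ has constant slope $2+\sqrt5$: for every $k\in\mathbb Z$, $F$ is affine with slope $2+\sqrt5$ on $[k,k+b]$ and affine with slope $-(2+\sqrt5)$ on $[k+b,k+1]$. 2. $f$ is continuous, countably piecewise monotone and Markov with respect to $P$. 3. $f$ is topologically mixing: for all nonempty open $U,V\subset[0,1]$ there is $n_0$ with $f^n(U)\cap V\ne\emptyset$ for all $n\ge n_0$. 4. For real $\lambda$, the matrix $T$ has a nonnegative eigenvector with eigenvalue $\lambda$ if and only if $\lambda\ge2+\sqrt5$; and every nonnegative eigenvector $v$ of $T$ is unsummable, $\sum_I v_I=\infty$. 5. For every $\lambda\ge2+\sqrt5$, $f$ is conjugate, via an increasing homeomorphism $\psi:[0,1]\to[-\infty,\infty]$, to a map of constant slope $\lambda$ on $[-\infty,\infty]$. 6. For every $\lambda>2+\sqrt5$ and every $a\in\mathbb R$, $f$ is conjugate, via increasing homeomorphisms, to a map of constant slope $\lambda$ on the extended half-line $[a,\infty]$ and to a map of constant slope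 $\lambda$ on the extended half-line $[-\infty,a]$. -/

import Mathlib

open Set

noncomputable section

namespace ConstantSlope

/-- The `P`-basic intervals: the connected components of the complement of `P`. -/
def basicIntervals {X : Type*} [TopologicalSpace X] (P : Set X) : Set (Set X) :=
  {I | ∃ x ∈ Pᶜ, I = connectedComponentIn Pᶜ x}

/-- `f` is a continuous, countably piecewise monotone and Markov self-map of `[a, b]`
with respect to the partition set `P`. -/
structure IsCPMM {α : Type*} [LinearOrder α] [TopologicalSpace α] {a b : α}
    (f : Icc a b → Icc a b) (P : Set (Icc a b)) : Prop where
  lt : a < b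
  continuous : Continuous f
  isClosed : IsClosed P
  countable : P.Countable
  endpoints_mem : ∀ x : Icc a b, (x : α) = a ∨ (x : α) = b → x ∈ P
  mapsTo : MapsTo f P P
  monotone : ∀ I ∈ basicIntervals P, MonotoneOn f I ∨ AntitoneOn f I

/-- The self-map `g` of `[a, b] ⊆ [-∞, ∞]` belongs to the class of continuous, countably piecewise
monotone and Markov maps, and it has constant slope `lam`: on each basic interval it is affine
with slope of absolute value `lam`. The endpoints `a, b` lie in the partition set, so that all
points of a basic interval are real numbers. -/
def HasConstantSlope {a b : EReal} (g : Icc a b → Icc a b) (lam : ℝ) : Prop :=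
  ∃ Q : Set (Icc a b), IsCPMM g Q ∧
    ∀ I ∈ basicIntervals Q, ∃ s c : ℝ, |s| = lam ∧
      ∀ x ∈ I, (g x : EReal) = ((s * (x : EReal).toReal + c : ℝ) : EReal)

/-- `f` is conjugate, via an increasing homeomorphism, to a map of constant slope `lam`
on `[a, b] ⊆ [-∞, ∞]`. -/
def IsConjugateToConstantSlope {X : Type*} [TopologicalSpace X] [Preorder X]
    (f : X → X) (a b : EReal) (lam : ℝ) : Prop :=
  ∃ (ψ : X ≃ₜ Icc a b) (g : Icc a b → Icc a b),
    StrictMono ψ ∧ (∀ x, ψ (f x) = g (ψ x)) ∧ HasConstantSlope g lam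

/-- Topological mixing. -/
def IsTopologicallyMixing {X : Type*} [TopologicalSpace X] (f : X → X) : Prop :=
  ∀ U V : Set X, IsOpen U → U.Nonempty → IsOpen V → V.Nonempty →
    ∃ n₀ : ℕ, ∀ n ≥ n₀, (f^[n] '' U ∩ V).Nonempty

open Classical in
/-- The binary transition matrix of `f` with respect to the partition set `P`. -/
def transitionMatrix {X : Type*} [TopologicalSpace X] (f : X → X) (P : Set X) :
    Matrix (basicIntervals P) (basicIntervals P) ℝ :=
  fun I J => if (J : Set X) ⊆ f '' (I : Set X) then 1 else 0

/-- `v` is a (nonzero) entrywise nonnegative eigenvector, with eigenvalue `lam`, of the possibly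
infinite matrix `T`; the series that define `T v` are required to converge. -/
structure IsNonnegEigenvector {ι : Type*} (T : Matrix ι ι ℝ) (lam : ℝ) (v : ι → ℝ) : Prop where
  ne_zero : v ≠ 0
  nonneg : ∀ i, 0 ≤ v i
  eigen : ∀ i, HasSum (fun j => T i j * v j) (lam * v i)

/-- The number `b = (√5 - 1) / 2`. -/
def dotB : ℝ := (√5 - 1) / 2

/-- The piecewise affine map which interpolates linearly between the consecutive dots
`(k, k - 1)`, `(k + b, k + b + 1)`, `(k + 1, k)`, for `k ∈ ℤ`. -/
def mapF (x : ℝ) : ℝ :=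
  if Int.fract x ≤ dotB then
    AffineMap.lineMap ((⌊x⌋ : ℝ) - 1) ((⌊x⌋ : ℝ) + dotB + 1) (Int.fract x / dotB)
  else
    AffineMap.lineMap ((⌊x⌋ : ℝ) + dotB + 1) (⌊x⌋ : ℝ) ((Int.fract x - dotB) / (1 - dotB))

open Classical in
/-- The self-map `h⁻¹ ∘ F ∘ h` of `(0, 1)`, with additional fixed points at `0` and `1`. -/
def mapf (h : Ioo (0 : ℝ) 1 ≃ₜ ℝ) (x : Icc (0 : ℝ) 1) : Icc (0 : ℝ) 1 :=
  if hx : (x : ℝ) ∈ Ioo (0 : ℝ) 1 then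
    ⟨h.symm (mapF (h ⟨x, hx⟩)), Ioo_subset_Icc_self (h.symm (mapF (h ⟨x, hx⟩))).2⟩
  else x

/-- The partition set `{0, 1} ∪ {h⁻¹(k), h⁻¹(k + b) : k ∈ ℤ}`. -/
def partitionP (h : Ioo (0 : ℝ) 1 ≃ₜ ℝ) : Set (Icc (0 : ℝ) 1) :=
  {x | (x : ℝ) = 0 ∨ (x : ℝ) = 1 ∨
    ∃ k : ℤ, (x : ℝ) = h.symm (k : ℝ) ∨ (x : ℝ) = h.symm ((k : ℝ) + dotB)}

end ConstantSlope

end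

/-!
The grid `ℤ ∪ (ℤ + b)` is invariant under `F`, and `F` stretches its pieces by the factor
`2 + √5 > 2`. Hence the iterated images of an interval grow until they contain a piece, and from
then on they absorb at least one further piece on each side at every step: this is mixing. Since
`F x - x` is bounded, `F` extends to `[-∞, ∞]`, and `f` is a copy of this extension; because
`F (b - x) = b - F x`, a decreasing `h` may be replaced by `b - h`.

In an increasing coordinate `φ` in which `F` has slopes `±λ`, the increments of `φ` along the grid
form a nonnegative eigenvector of `T` with eigenvalue `λ`. Conversely, an increasing sequence with
such increments extends to a coordinate `φ`: it is a fixed point of the operator that pulls `φ` back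
along `F` and rescales by `1 / λ`, and the iterates of this operator converge as soon as the
increments grow along `F` by a factor less than `λ`. The expansion of `F` makes `φ` injective.

Eliminating the odd entries of an eigenvector leaves the recurrence
`λ (x (k + 1) + x (k - 1)) = (λ² - 2 λ - 1) x k` for the even ones. It has a positive solution if
and only if `λ² - 2 λ - 1 ≥ 2 λ`, that is `λ ≥ 2 + √5`, and then every positive solution is convex,
hence unsummable. For `λ > 2 + √5` there is a solution `x k = t ^ k` with `1 < t < λ`. It is
summable towards `-∞`, which gives a model on `[a, ∞]`; its mirror image under `x ↦ b - x` gives a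
model on `[-∞, a]`, and their sum one on `[-∞, ∞]`. For `λ = 2 + √5` the latter is `F` itself.
-/

namespace ConstantSlope

open Filter Topology

/-! ### Grids -/

section Grid

variable {α β : Type*} [LinearOrder α] {d : ℤ → α} {x : α} {i j : ℤ}

/-- A strictly increasing two-sided sequence that is unbounded in both directions. It cuts the line
into the pieces `Icc (d j) (d (j + 1))`. -/
structure IsGrid (d : ℤ → α) : Prop where
  strictMono : StrictMono d
  tendsto_atTop : Tendsto d atTop atTop
  tendsto_atBot : Tendsto d atBot atBot

/-- The `j`-th piece of a grid. -/
abbrev piece (d : ℤ → α) (j : ℤ) : Set α := Icc (d j) (d (j + 1))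

/-- The index of the half-open piece of a grid that contains a point. -/
noncomputable def gridIndex (d : ℤ → α) (x : α) : ℤ := sSup {j | d j ≤ x}

/-- The function that equals `c j` on the `j`-th piece of a grid. -/
noncomputable def glue (d : ℤ → α) (c : ℤ → α → β) (x : α) : β := c (gridIndex d x) x

theorem left_mem_piece (hd : Monotone d) (j : ℤ) : d j ∈ piece d j :=
  left_mem_Icc.2 (hd (lt_add_one j).le)

theorem right_mem_piece (hd : Monotone d) (j : ℤ) : d (j + 1) ∈ piece d j :=
  right_mem_Icc.2 (hd (lt_add_one j).le)

namespace IsGrid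

theorem lt_succ (hd : IsGrid d) (j : ℤ) : d j < d (j + 1) := hd.strictMono (lt_add_one j)

theorem locallyFinite_piece [NoMaxOrder α] [NoMinOrder α] [TopologicalSpace α] [OrderTopology α]
    (hd : IsGrid d) : LocallyFinite (piece d) :=
  locallyFinite_Icc_of_tendsto hd.tendsto_atTop
    (hd.tendsto_atBot.comp (tendsto_atBot_add_const_right _ 1 tendsto_id))

variable [NoMaxOrder α]

theorem mem_Ico_gridIndex (hd : IsGrid d) (x : α) :
    x ∈ Ico (d (gridIndex d x)) (d (gridIndex d x + 1)) := by
  obtain ⟨N, hN⟩ := (hd.tendsto_atTop.eventually_gt_atTop x).exists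
  have hbdd : BddAbove {j | d j ≤ x} :=
    ⟨N, fun j hj => (hd.strictMono.lt_iff_lt.1 (hj.trans_lt hN)).le⟩
  have hne : {j | d j ≤ x}.Nonempty := (hd.tendsto_atBot.eventually_le_atBot x).exists
  refine ⟨Int.csSup_mem hne hbdd, not_le.1 fun h => ?_⟩
  exact (lt_add_one (gridIndex d x)).not_ge (le_csSup hbdd h)

theorem mem_piece_gridIndex (hd : IsGrid d) (x : α) : x ∈ piece d (gridIndex d x) :=
  Ico_subset_Icc_self (hd.mem_Ico_gridIndex x)

theorem gridIndex_eq (hd : IsGrid d) (hx : x ∈ Ico (d j) (d (j + 1))) : gridIndex d x = j := by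
  have h := hd.mem_Ico_gridIndex x
  have h₁ := hd.strictMono.lt_iff_lt.1 (h.1.trans_lt hx.2)
  have h₂ := hd.strictMono.lt_iff_lt.1 (hx.1.trans_lt h.2)
  omega

theorem glue_eq (hd : IsGrid d) {c : ℤ → α → β}
    (hc : ∀ j, c j (d (j + 1)) = c (j + 1) (d (j + 1))) (hx : x ∈ piece d j) :
    glue d c x = c j x := by
  rcases hx.2.eq_or_lt with rfl | h
  · rw [glue, hd.gridIndex_eq (left_mem_Ico.2 (hd.lt_succ (j + 1))), hc]
  · rw [glue, hd.gridIndex_eq ⟨hx.1, h⟩]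

theorem continuous_of_continuousOn_piece [NoMinOrder α] [TopologicalSpace α] [OrderTopology α]
    [TopologicalSpace β] (hd : IsGrid d) {f : α → β} (hf : ∀ j, ContinuousOn f (piece d j)) :
    Continuous f :=
  hd.locallyFinite_piece.continuous
    (eq_univ_of_forall fun x => mem_iUnion.2 ⟨_, hd.mem_piece_gridIndex x⟩)
    (fun _ => isClosed_Icc) hf

theorem monotone_of_monotoneOn_piece [Preorder β] (hd : IsGrid d) {f : α → β}
    (hf : ∀ j, MonotoneOn f (piece d j)) : Monotone f := by
  have hgrid : Monotone (f ∘ d) := monotone_int_of_le_succ fun j =>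
    hf j (left_mem_piece hd.strictMono.monotone j) (right_mem_piece hd.strictMono.monotone j)
      (hd.lt_succ j).le
  intro x y hxy
  have hx := hd.mem_piece_gridIndex x
  have hy := hd.mem_piece_gridIndex y
  have hle : gridIndex d x < gridIndex d y + 1 :=
    hd.strictMono.lt_iff_lt.1 ((hx.1.trans hxy).trans_lt (hd.mem_Ico_gridIndex y).2)
  rcases (Int.lt_add_one_iff.1 hle).eq_or_lt with heq | hlt
  · rw [heq] at hx
    exact hf _ hx hy hxy
  · calc f x ≤ f (d (gridIndex d x + 1)) :=
          hf _ hx (right_mem_piece hd.strictMono.monotone _) hx.2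
      _ ≤ f (d (gridIndex d y)) := hgrid hlt
      _ ≤ f y := hf _ (left_mem_piece hd.strictMono.monotone _) hy hy.1

end IsGrid

end Grid

/-- The two-sided sequence whose even terms are `p` and whose odd terms are `q`. -/
def interleave {α : Type*} (p q : ℤ → α) (j : ℤ) : α := if Even j then p (j / 2) else q (j / 2)

section Interleave

variable {α : Type*} {p q : ℤ → α} {l : Filter α}

theorem interleave_even (p q : ℤ → α) (k : ℤ) : interleave p q (2 * k) = p k := by
  simp [interleave]

theorem interleave_odd (p q : ℤ → α) (k : ℤ) : interleave p q (2 * k + 1) = q k := by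
  have h : (2 * k + 1) / 2 = k := by omega
  simp [interleave, h]

theorem interleave_odd_add_one (p q : ℤ → α) (k : ℤ) :
    interleave p q (2 * k + 1 + 1) = p (k + 1) := by
  rw [show 2 * k + 1 + 1 = 2 * (k + 1) by ring, interleave_even]

theorem interleave_strictMono [Preorder α] (h₁ : ∀ k, p k < q k) (h₂ : ∀ k, q k < p (k + 1)) :
    StrictMono (interleave p q) := by
  refine strictMono_int_of_lt_succ fun j => ?_
  obtain ⟨k, rfl | rfl⟩ := Int.even_or_odd' j
  · rw [interleave_even, interleave_odd]
    exact h₁ k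
  · rw [interleave_odd, interleave_odd_add_one]
    exact h₂ k

theorem interleave_tendsto_atTop (hp : Tendsto p atTop l) (hq : Tendsto q atTop l) :
    Tendsto (interleave p q) atTop l := by
  have hdiv : Tendsto (fun j : ℤ => j / 2) atTop atTop :=
    tendsto_atTop.2 fun b => (eventually_ge_atTop (2 * b)).mono fun j hj => by omega
  exact (hp.comp hdiv).if' (hq.comp hdiv)

theorem interleave_tendsto_atBot (hp : Tendsto p atBot l) (hq : Tendsto q atBot l) :
    Tendsto (interleave p q) atBot l := by
  have hdiv : Tendsto (fun j : ℤ => j / 2) atBot atBot :=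
    tendsto_atBot.2 fun b => (eventually_le_atBot (2 * b)).mono fun j hj => by omega
  exact (hp.comp hdiv).if' (hq.comp hdiv)

end Interleave

/-! ### Markov maps of the line -/

/-- `G` is a continuous self-map of the line that maps the grid `d` into itself, by `τ` on the
indices, and is injective on each piece. -/
structure IsMarkovMap (d : ℤ → ℝ) (τ : ℤ → ℤ) (G : ℝ → ℝ) : Prop where
  isGrid : IsGrid d
  continuous : Continuous G
  map_grid : ∀ j, G (d j) = d (τ j)
  injOn : ∀ j, InjOn G (piece d j)

/-- The indices of the pieces covered by the image of the `i`-th piece under a Markov map that acts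
by `τ` on the indices of the grid. -/
noncomputable def coveredPieces (τ : ℤ → ℤ) (i : ℤ) : Finset ℤ :=
  Finset.Ico (min (τ i) (τ (i + 1))) (max (τ i) (τ (i + 1)))

/-- The increasing sequence `D` is the image of the grid of a Markov map in a model of constant
slope `lam`: the map stretches the interval between consecutive terms by the factor `lam`. -/
structure IsSlopeGrid (τ : ℤ → ℤ) (lam : ℝ) (D : ℤ → ℝ) : Prop where
  strictMono : StrictMono D
  abs_sub_eq : ∀ j, |D (τ (j + 1)) - D (τ j)| = lam * (D (j + 1) - D j)

/-- In the coordinate `φ`, the map `G` is affine with slope `±lam` on each piece of the grid. -/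
def HasSlopeAlong (d : ℤ → ℝ) (G φ : ℝ → ℝ) (lam : ℝ) : Prop :=
  ∀ j, ∃ s c : ℝ, |s| = lam ∧ ∀ x ∈ piece d j, φ (G x) = s * φ x + c

theorem sum_Ico_sub_int {M : Type*} [AddCommGroup M] (f : ℤ → M) {m n : ℤ} (h : m ≤ n) :
    ∑ j ∈ Finset.Ico m n, (f (j + 1) - f j) = f n - f m := by
  induction n, h using Int.leInduction with
  | base => simp
  | succ n hmn ih =>
    rw [← Finset.insert_Ico_right_eq_Ico_add_one hmn, Finset.sum_insert Finset.right_notMem_Ico, ih]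
    abel

section Markov

variable {d D : ℤ → ℝ} {τ : ℤ → ℤ} {G φ φ' : ℝ → ℝ} {lam : ℝ} {i j : ℤ} {x y : ℝ}

namespace IsMarkovMap

theorem strictMonoOn_or_strictAntiOn (hG : IsMarkovMap d τ G) (j : ℤ) :
    StrictMonoOn G (piece d j) ∨ StrictAntiOn G (piece d j) :=
  hG.continuous.continuousOn.strictMonoOn_of_injOn_Icc' (hG.isGrid.lt_succ j).le (hG.injOn j)

theorem image_Ioo (hG : IsMarkovMap d τ G) (j : ℤ) :
    G '' Ioo (d j) (d (j + 1)) =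
      Ioo (d (min (τ j) (τ (j + 1)))) (d (max (τ j) (τ (j + 1)))) := by
  have hle := (hG.isGrid.lt_succ j).le
  have hcont : ContinuousOn G (piece d j) := hG.continuous.continuousOn
  rw [hG.isGrid.strictMono.monotone.map_min, hG.isGrid.strictMono.monotone.map_max,
    ← hG.map_grid, ← hG.map_grid]
  have hleft := left_mem_piece hG.isGrid.strictMono.monotone j
  have hright := right_mem_piece hG.isGrid.strictMono.monotone j
  rcases hG.strictMonoOn_or_strictAntiOn j with h | h
  · have hGle := h.monotoneOn hleft hright hle
    rw [min_eq_left hGle, max_eq_right hGle, hcont.image_Ioo_of_strictMonoOn hle h]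
  · have hGle := h.antitoneOn hleft hright hle
    rw [min_eq_right hGle, max_eq_left hGle, hcont.image_Ioo_of_strictAntiOn hle h]

theorem Ioo_subset_image_Ioo_iff (hG : IsMarkovMap d τ G) :
    Ioo (d j) (d (j + 1)) ⊆ G '' Ioo (d i) (d (i + 1)) ↔ j ∈ coveredPieces τ i := by
  have hd := hG.isGrid.strictMono
  rw [hG.image_Ioo, Ioo_subset_Ioo_iff (hG.isGrid.lt_succ j), hd.le_iff_le, hd.le_iff_le,
    coveredPieces, Finset.mem_Ico, Int.add_one_le_iff]

end IsMarkovMap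

namespace IsSlopeGrid

theorem sum_coveredPieces (hD : IsSlopeGrid τ lam D) (i : ℤ) :
    ∑ j ∈ coveredPieces τ i, (D (j + 1) - D j) = lam * (D (i + 1) - D i) := by
  rw [coveredPieces, sum_Ico_sub_int _ min_le_max, hD.strictMono.monotone.map_max,
    hD.strictMono.monotone.map_min, max_sub_min_eq_abs, hD.abs_sub_eq]

end IsSlopeGrid

namespace HasSlopeAlong

theorem abs_sub_eq (hs : HasSlopeAlong d G φ lam) (hx : x ∈ piece d j) (hy : y ∈ piece d j) :
    |φ (G x) - φ (G y)| = lam * |φ x - φ y| := by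
  obtain ⟨s, c, rfl, hsc⟩ := hs j
  rw [hsc x hx, hsc y hy, add_sub_add_right_eq_sub, ← mul_sub, abs_mul]

theorem isSlopeGrid (hs : HasSlopeAlong d G φ lam) (hG : IsMarkovMap d τ G) (hφ : StrictMono φ) :
    IsSlopeGrid τ lam (φ ∘ d) where
  strictMono := hφ.comp hG.isGrid.strictMono
  abs_sub_eq j := by
    have hd := hG.isGrid.strictMono.monotone
    simp only [Function.comp_apply]
    rw [← hG.map_grid, ← hG.map_grid,
      hs.abs_sub_eq (right_mem_piece hd j) (left_mem_piece hd j),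
      abs_of_nonneg (sub_nonneg.2 (hφ.monotone (hG.isGrid.lt_succ j).le))]

theorem add (hs : HasSlopeAlong d G φ lam) (hs' : HasSlopeAlong d G φ' lam)
    (hG : IsMarkovMap d τ G) (hφ : StrictMono φ) (hφ' : StrictMono φ') :
    HasSlopeAlong d G (fun x => φ x + φ' x) lam := by
  intro j
  obtain ⟨s, c, hslope, hsc⟩ := hs j
  obtain ⟨s', c', hslope', hsc'⟩ := hs' j
  have hlt := hG.isGrid.lt_succ j
  have hleft := left_mem_piece hG.isGrid.strictMono.monotone j
  have hright := right_mem_piece hG.isGrid.strictMono.monotone j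
  have hsub : φ (G (d (j + 1))) - φ (G (d j)) = s * (φ (d (j + 1)) - φ (d j)) := by
    rw [hsc _ hright, hsc _ hleft]
    ring
  have hsub' : φ' (G (d (j + 1))) - φ' (G (d j)) = s' * (φ' (d (j + 1)) - φ' (d j)) := by
    rw [hsc' _ hright, hsc' _ hleft]
    ring
  have hpos := sub_pos.2 (hφ hlt)
  have hpos' := sub_pos.2 (hφ' hlt)
  have hseq : s = s' := by
    rcases le_total (G (d j)) (G (d (j + 1))) with hle | hle
    · have hs0 := nonneg_of_mul_nonneg_left (hsub ▸ sub_nonneg.2 (hφ.monotone hle)) hpos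
      have hs0' := nonneg_of_mul_nonneg_left (hsub' ▸ sub_nonneg.2 (hφ'.monotone hle)) hpos'
      rw [← abs_of_nonneg hs0, ← abs_of_nonneg hs0', hslope, hslope']
    · have hs0 := nonpos_of_mul_nonpos_left (hsub ▸ sub_nonpos.2 (hφ.monotone hle)) hpos
      have hs0' := nonpos_of_mul_nonpos_left (hsub' ▸ sub_nonpos.2 (hφ'.monotone hle)) hpos'
      rw [← neg_inj, ← abs_of_nonpos hs0, ← abs_of_nonpos hs0', hslope, hslope']
  refine ⟨s, c + c', hslope, fun x hx => ?_⟩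
  beta_reduce
  rw [hsc x hx, hsc' x hx, hseq]
  ring

theorem add_const (hs : HasSlopeAlong d G φ lam) (a : ℝ) :
    HasSlopeAlong d G (fun x => φ x + a) lam := by
  intro j
  obtain ⟨s, c, hslope, hsc⟩ := hs j
  refine ⟨s, c + a - s * a, hslope, fun x hx => ?_⟩
  beta_reduce
  rw [hsc x hx]
  ring

theorem neg_comp (hs : HasSlopeAlong d G φ lam) {R : ℝ → ℝ} (hR : Function.Semiconj R G G)
    (hmaps : ∀ j, ∃ i, MapsTo R (piece d j) (piece d i)) :
    HasSlopeAlong d G (fun x => -φ (R x)) lam := by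
  intro j
  obtain ⟨i, hi⟩ := hmaps j
  obtain ⟨s, c, hslope, hsc⟩ := hs i
  refine ⟨s, -c, hslope, fun x hx => ?_⟩
  beta_reduce
  rw [hR x, hsc _ (hi hx)]
  ring

end HasSlopeAlong

/-! ### Expansion -/

theorem IsGrid.exists_piece_subset_Icc (hd : IsGrid d) {L : ℝ} (hmesh : ∀ j, d (j + 1) - d j ≤ L)
    (hL : 2 * L ≤ y - x) : ∃ j, piece d j ⊆ Icc x y := by
  have hx := hd.mem_Ico_gridIndex x
  have h₁ := hmesh (gridIndex d x)
  have h₂ := hmesh (gridIndex d x + 1)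
  exact ⟨gridIndex d x + 1, Icc_subset_Icc hx.2.le (by linarith [hx.1])⟩

theorem IsGrid.exists_half_subset_piece (hd : IsGrid d) (hxy : x ≤ y)
    (hno : ∀ j, ¬piece d j ⊆ Icc x y) :
    ∃ j, ∃ x' ∈ piece d j, ∃ y' ∈ piece d j, x ≤ x' ∧ y' ≤ y ∧ (y - x) / 2 ≤ y' - x' := by
  have hx := hd.mem_Ico_gridIndex x
  generalize gridIndex d x = j at hx
  rcases le_or_gt y (d (j + 1)) with hy | hy
  · exact ⟨j, x, ⟨hx.1, hx.2.le⟩, y, ⟨hx.1.trans hxy, hy⟩, le_rfl, le_rfl, by linarith⟩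
  have hy' : y ≤ d (j + 1 + 1) := (not_le.1 fun h => hno _ (Icc_subset_Icc hx.2.le h)).le
  rcases le_total (y - d (j + 1)) (d (j + 1) - x) with h | h
  · exact ⟨j, x, ⟨hx.1, hx.2.le⟩, d (j + 1), right_mem_piece hd.strictMono.monotone j, le_rfl,
      hy.le, by linarith⟩
  · exact ⟨j + 1, d (j + 1), left_mem_piece hd.strictMono.monotone _, y, ⟨hy.le, hy'⟩, hx.2.le,
      le_rfl, by linarith⟩

/-- An interval inside one piece is stretched by `μ`, and an interval that contains no piece meets
at most two of them, so that half of it lies in one piece: since `μ / 2 > 1`, the iterated images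
grow until they contain a piece. -/
theorem IsGrid.exists_piece_subset_iterate_image (hd : IsGrid d) {L μ : ℝ}
    (hmesh : ∀ j, d (j + 1) - d j ≤ L) (hG : Continuous G) (hμ : 2 < μ)
    (hexp : ∀ j, ∀ x ∈ piece d j, ∀ y ∈ piece d j, μ * |x - y| ≤ |G x - G y|) (hxy : x < y) :
    ∃ (n : ℕ) (j : ℤ), piece d j ⊆ G^[n] '' Icc x y := by
  by_contra! hno
  have hgrow : ∀ n : ℕ, ∃ p q, Icc p q ⊆ G^[n] '' Icc x y ∧ (μ / 2) ^ n * (y - x) ≤ q - p := by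
    intro n
    induction n with
    | zero => exact ⟨x, y, by simp, by simp⟩
    | succ n ih =>
      obtain ⟨p, q, hpq, hlen⟩ := ih
      have hle : p ≤ q := sub_nonneg.1 (le_trans (by have := sub_pos.2 hxy; positivity) hlen)
      obtain ⟨j, p', hp', q', hq', hpp', hqq', hhalf⟩ :=
        hd.exists_half_subset_piece hle fun j hj => hno n j (hj.trans hpq)
      refine ⟨min (G p') (G q'), max (G p') (G q'), ?_, ?_⟩
      · have hpq' : p' ≤ q' := by linarith
        rw [Function.iterate_succ', image_comp]
        calc Icc (min (G p') (G q')) (max (G p') (G q')) ⊆ G '' uIcc p' q' :=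
              intermediate_value_uIcc hG.continuousOn
          _ ⊆ G '' (G^[n] '' Icc x y) := by
              rw [uIcc_of_le hpq']
              exact image_mono ((Icc_subset_Icc hpp' hqq').trans hpq)
      · calc (μ / 2) ^ (n + 1) * (y - x) = μ / 2 * ((μ / 2) ^ n * (y - x)) := by ring
          _ ≤ μ * ((q - p) / 2) := by nlinarith
          _ ≤ μ * |q' - p'| := by
              gcongr
              exact hhalf.trans (le_abs_self _)
          _ ≤ |G q' - G p'| := hexp j q' hq' p' hp'
          _ = max (G p') (G q') - min (G p') (G q') := (max_sub_min_eq_abs _ _).symm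
  obtain ⟨n, hn⟩ := pow_unbounded_of_one_lt (2 * L / (y - x)) (by linarith : 1 < μ / 2)
  obtain ⟨p, q, hpq, hlen⟩ := hgrow n
  rw [div_lt_iff₀ (sub_pos.2 hxy)] at hn
  obtain ⟨j, hj⟩ := hd.exists_piece_subset_Icc hmesh (hn.le.trans hlen)
  exact hno n j (hj.trans hpq)

/-! ### Interpolation of slope grids -/

theorem exists_continuous_tendsto_of_dist_le_geometric {X Y : Type*} [TopologicalSpace X]
    [MetricSpace Y] [CompleteSpace Y] {u : ℕ → X → Y} {w : X → ℝ} {r : ℝ} (hr₀ : 0 ≤ r) (hr : r < 1)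
    (hu : ∀ n, Continuous (u n)) (hw : Continuous w)
    (hdist : ∀ n x, dist (u n x) (u (n + 1) x) ≤ w x * r ^ n) :
    ∃ v : X → Y, Continuous v ∧ ∀ x, Tendsto (fun n => u n x) atTop (𝓝 (v x)) := by
  choose v hv using fun x => cauchySeq_tendsto_of_complete
    (cauchySeq_of_le_geometric r (w x) hr fun n => hdist n x)
  have hbound : ∀ n x, dist (u n x) (v x) ≤ w x * r ^ n / (1 - r) := fun n x =>
    dist_le_of_le_geometric_of_tendsto r (w x) hr (fun n => hdist n x) (hv x) n
  have hlocal : TendstoLocallyUniformly u v atTop := by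
    refine Metric.tendstoLocallyUniformly_iff.2 fun ε hε x => ?_
    refine ⟨{y | w y < w x + 1}, (isOpen_lt hw continuous_const).mem_nhds (lt_add_one (w x)), ?_⟩
    have hlim : Tendsto (fun n => (w x + 1) * r ^ n / (1 - r)) atTop (𝓝 0) := by
      simpa using ((tendsto_pow_atTop_nhds_zero_of_lt_one hr₀ hr).const_mul (w x + 1)).div_const
        (1 - r)
    filter_upwards [hlim.eventually_lt_const hε] with n hn y hy
    rw [dist_comm]
    refine (hbound n y).trans_lt (lt_of_le_of_lt ?_ hn)
    have := sub_pos.2 hr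
    gcongr
  exact ⟨v, hlocal.continuous (Frequently.of_forall hu), hv⟩

/-- `φ` is a continuous monotone function that maps the grid `d` to the sequence `D`. -/
structure Interpolates (d D : ℤ → ℝ) (φ : ℝ → ℝ) : Prop where
  continuous : Continuous φ
  monotone : Monotone φ
  apply_grid : ∀ j, φ (d j) = D j

theorem IsGrid.exists_interpolates (hd : IsGrid d) (hD : Monotone D) : ∃ φ, Interpolates d D φ := by
  let c : ℤ → ℝ → ℝ := fun j x => D j + (D (j + 1) - D j) / (d (j + 1) - d j) * (x - d j)
  have hpos : ∀ j, 0 < d (j + 1) - d j := fun j => sub_pos.2 (hd.lt_succ j)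
  have heq : ∀ {j x}, x ∈ piece d j → glue d c x = c j x := fun hx =>
    hd.glue_eq (fun j => by simp [c, div_mul_cancel₀ _ (hpos j).ne']) hx
  refine ⟨glue d c, hd.continuous_of_continuousOn_piece fun j => ?_,
    hd.monotone_of_monotoneOn_piece fun j x hx y hy hxy => ?_, fun j => ?_⟩
  · exact ContinuousOn.congr (by fun_prop) fun _ hx => heq hx
  · simp only [heq hx, heq hy, c]
    have := (hpos j).le
    have := sub_nonneg.2 (hD (lt_add_one j).le)
    gcongr
  · rw [heq (left_mem_piece hd.strictMono.monotone j)]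
    simp [c]

theorem Interpolates.mem_Icc (hφ : Interpolates d D φ) (hx : x ∈ piece d j) :
    φ x ∈ Icc (D j) (D (j + 1)) := by
  rw [← hφ.apply_grid, ← hφ.apply_grid]
  exact ⟨hφ.monotone hx.1, hφ.monotone hx.2⟩

/-- The operator on interpolations `φ` of `D` whose fixed points are the coordinates in which `G`
has constant slope `lam`: on a piece, `φ` is replaced by the distance that `φ ∘ G` has travelled
since the left end of the piece, scaled by `1 / lam`. -/
noncomputable def pullback (d : ℤ → ℝ) (τ : ℤ → ℤ) (G : ℝ → ℝ) (lam : ℝ) (D : ℤ → ℝ) (φ : ℝ → ℝ) :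
    ℝ → ℝ :=
  glue d fun j x => D j + |φ (G x) - D (τ j)| / lam

theorem abs_pullback_sub_le (hlam : 0 ≤ lam) (φ χ : ℝ → ℝ) (x : ℝ) :
    |pullback d τ G lam D φ x - pullback d τ G lam D χ x| ≤ |φ (G x) - χ (G x)| / lam := by
  simp only [pullback, glue]
  rw [add_sub_add_left_eq_sub, ← sub_div, abs_div, abs_of_nonneg hlam]
  refine div_le_div_of_nonneg_right ?_ hlam
  simpa only [sub_sub_sub_cancel_right] using abs_abs_sub_abs_le
    (φ (G x) - D (τ (gridIndex d x))) (χ (G x) - D (τ (gridIndex d x)))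

theorem monotoneOn_abs_sub_left {f : ℝ → ℝ} {a b : ℝ}
    (hf : MonotoneOn f (Icc a b) ∨ AntitoneOn f (Icc a b)) :
    MonotoneOn (fun x => |f x - f a|) (Icc a b) := by
  intro x hx y hy hxy
  have ha : a ∈ Icc a b := left_mem_Icc.2 (hx.1.trans hx.2)
  rcases hf with hf | hf
  · exact abs_le_abs_of_nonneg (sub_nonneg.2 (hf ha hx hx.1)) (sub_le_sub_right (hf hx hy hxy) _)
  · exact abs_le_abs_of_nonpos (sub_nonpos.2 (hf ha hx hx.1)) (sub_le_sub_right (hf hx hy hxy) _)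

section Pullback

variable (hG : IsMarkovMap d τ G) (hD : IsSlopeGrid τ lam D)
include hG hD

theorem pullback_apply (hlam : 0 < lam) (hφ : Interpolates d D φ) (hx : x ∈ piece d j) :
    pullback d τ G lam D φ x = D j + |φ (G x) - D (τ j)| / lam := by
  refine hG.isGrid.glue_eq (fun j => ?_) hx
  rw [hG.map_grid, hφ.apply_grid, hD.abs_sub_eq, sub_self, abs_zero,
    mul_div_cancel_left₀ _ hlam.ne']
  ring

theorem interpolates_pullback (hlam : 0 < lam) (hφ : Interpolates d D φ) :
    Interpolates d D (pullback d τ G lam D φ) where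
  continuous := hG.isGrid.continuous_of_continuousOn_piece fun j => by
    refine ContinuousOn.congr (Continuous.continuousOn ?_) fun _ hx =>
      pullback_apply hG hD hlam hφ hx
    have := hφ.continuous
    have := hG.continuous
    fun_prop
  monotone := hG.isGrid.monotone_of_monotoneOn_piece fun j x hx y hy hxy => by
    have hcomp : MonotoneOn (φ ∘ G) (piece d j) ∨ AntitoneOn (φ ∘ G) (piece d j) :=
      (hG.strictMonoOn_or_strictAntiOn j).imp (fun h => hφ.monotone.comp_monotoneOn h.monotoneOn)
        (fun h => hφ.monotone.comp_antitoneOn h.antitoneOn)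
    have habs := monotoneOn_abs_sub_left hcomp hx hy hxy
    simp only [Function.comp_apply, hG.map_grid, hφ.apply_grid] at habs
    rw [pullback_apply hG hD hlam hφ hx, pullback_apply hG hD hlam hφ hy]
    gcongr
  apply_grid j := by
    rw [pullback_apply hG hD hlam hφ (left_mem_piece hG.isGrid.strictMono.monotone j), hG.map_grid,
      hφ.apply_grid]
    simp

theorem interpolates_iterate_pullback (hlam : 0 < lam) (hφ : Interpolates d D φ) (n : ℕ) :
    Interpolates d D ((pullback d τ G lam D)^[n] φ) :=
  Function.Iterate.rec _ hφ (fun _ => interpolates_pullback hG hD hlam) n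

/-- The weight `w` measures the lengths of the pieces; it grows along `G` by a factor less than
`lam`, so the iterates of `pullback` form a locally uniform geometric Cauchy sequence. -/
theorem abs_iterate_pullback_sub_le {w : ℝ → ℝ} {r : ℝ} (hlam : 0 < lam)
    (hφ : Interpolates d D φ) (hwG : ∀ x, w (G x) ≤ r * w x) (hr : 0 ≤ r)
    (hwD : ∀ j, ∀ x ∈ piece d j, D (j + 1) - D j ≤ w x) (n : ℕ) (x : ℝ) :
    |(pullback d τ G lam D)^[n] φ x -
      (pullback d τ G lam D)^[n + 1] φ x| ≤ w x * (r / lam) ^ n := by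
  induction n generalizing x with
  | zero =>
    have hx := hG.isGrid.mem_piece_gridIndex x
    calc |φ x - pullback d τ G lam D φ x|
        ≤ D (gridIndex d x + 1) - D (gridIndex d x) :=
          Real.dist_le_of_mem_Icc (hφ.mem_Icc hx)
            ((interpolates_pullback hG hD hlam hφ).mem_Icc hx)
      _ ≤ w x * (r / lam) ^ 0 := by simpa using hwD _ x hx
  | succ n ih =>
    rw [Function.iterate_succ_apply', Function.iterate_succ_apply' _ (n + 1)]
    calc _ ≤ _ := abs_pullback_sub_le hlam.le _ _ x
      _ ≤ w (G x) * (r / lam) ^ n / lam := by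
        gcongr
        exact ih (G x)
      _ ≤ r * w x * (r / lam) ^ n / lam := by
        gcongr
        exact hwG x
      _ = w x * (r / lam) ^ (n + 1) := by ring

theorem IsSlopeGrid.exists_interpolates_eq {w : ℝ → ℝ} {r : ℝ} (hw : Continuous w)
    (hwG : ∀ x, w (G x) ≤ r * w x) (hr : 0 ≤ r) (hrlam : r < lam)
    (hwD : ∀ j, ∀ x ∈ piece d j, D (j + 1) - D j ≤ w x) :
    ∃ φ, Interpolates d D φ ∧ ∀ j, ∀ x ∈ piece d j, φ x = D j + |φ (G x) - D (τ j)| / lam := by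
  have hlam : 0 < lam := hr.trans_lt hrlam
  obtain ⟨φ₀, hφ₀⟩ := hG.isGrid.exists_interpolates hD.strictMono.monotone
  have hiter := interpolates_iterate_pullback hG hD hlam hφ₀
  obtain ⟨φ, hφ, hlim⟩ := exists_continuous_tendsto_of_dist_le_geometric (div_nonneg hr hlam.le)
    ((div_lt_one hlam).2 hrlam) (fun n => (hiter n).continuous) hw
    fun n x => abs_iterate_pullback_sub_le hG hD hlam hφ₀ hwG hr hwD n x
  refine ⟨φ, ⟨hφ, fun x y hxy => ?_, fun j => ?_⟩, fun j x hx => ?_⟩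
  · exact le_of_tendsto_of_tendsto' (hlim x) (hlim y) fun n => (hiter n).monotone hxy
  · refine tendsto_nhds_unique (hlim (d j)) ?_
    simp only [(hiter _).apply_grid, tendsto_const_nhds]
  · refine tendsto_nhds_unique ((tendsto_add_atTop_iff_nat 1).2 (hlim x)) ?_
    simp only [Function.iterate_succ_apply', pullback_apply hG hD hlam (hiter _) hx]
    exact ((((hlim (G x)).sub_const _).abs).div_const _).const_add _

end Pullback

theorem Interpolates.hasSlopeAlong (hG : IsMarkovMap d τ G) (hlam : 0 < lam)
    (hφ : Interpolates d D φ)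
    (heq : ∀ j, ∀ x ∈ piece d j, φ x = D j + |φ (G x) - D (τ j)| / lam) :
    HasSlopeAlong d G φ lam := by
  intro j
  have hleft := left_mem_piece hG.isGrid.strictMono.monotone j
  have hval : φ (G (d j)) = D (τ j) := by rw [hG.map_grid, hφ.apply_grid]
  have habs : ∀ x ∈ piece d j, |φ (G x) - D (τ j)| = lam * (φ x - D j) := fun x hx => by
    rw [heq j x hx]
    field_simp
    ring
  rcases hG.strictMonoOn_or_strictAntiOn j with h | h
  · refine ⟨lam, D (τ j) - lam * D j, abs_of_pos hlam, fun x hx => ?_⟩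
    have hle : D (τ j) ≤ φ (G x) := hval ▸ hφ.monotone (h.monotoneOn hleft hx hx.1)
    linear_combination (abs_of_nonneg (sub_nonneg.2 hle)).symm.trans (habs x hx)
  · refine ⟨-lam, D (τ j) + lam * D j, by rw [abs_neg, abs_of_pos hlam], fun x hx => ?_⟩
    have hle : φ (G x) ≤ D (τ j) := hval ▸ hφ.monotone (h.antitoneOn hleft hx hx.1)
    linear_combination -(abs_of_nonpos (sub_nonpos.2 hle)).symm.trans (habs x hx)

theorem IsGrid.abs_sub_le_of_piece (hd : IsGrid d) {f g : ℝ → ℝ}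
    (h : ∀ j, ∀ x ∈ piece d j, ∀ y ∈ piece d j, x ≤ y → |f y - f x| ≤ g y - g x) (hxy : x ≤ y) :
    |f y - f x| ≤ g y - g x := by
  have hsub : Monotone (g - f) := hd.monotone_of_monotoneOn_piece fun j x hx y hy hxy => by
    have := (abs_le.1 (h j x hx y hy hxy)).2
    simp only [Pi.sub_apply]
    linarith
  have hadd : Monotone (g + f) := hd.monotone_of_monotoneOn_piece fun j x hx y hy hxy => by
    have := (abs_le.1 (h j x hx y hy hxy)).1
    simp only [Pi.add_apply]
    linarith
  have h₁ := hsub hxy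
  have h₂ := hadd hxy
  simp only [Pi.sub_apply, Pi.add_apply] at h₁ h₂
  exact abs_le.2 ⟨by linarith, by linarith⟩

theorem HasSlopeAlong.abs_sub_le (hs : HasSlopeAlong d G φ lam) (hd : IsGrid d) (hφ : Monotone φ)
    (x y : ℝ) : |φ (G x) - φ (G y)| ≤ lam * |φ x - φ y| := by
  wlog hxy : y ≤ x generalizing x y
  · rw [abs_sub_comm, abs_sub_comm (φ x)]
    exact this y x (le_of_not_ge hxy)
  rw [abs_of_nonneg (sub_nonneg.2 (hφ hxy)), mul_sub]
  refine hd.abs_sub_le_of_piece (f := φ ∘ G) (g := fun z => lam * φ z)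
    (fun j u hu v hv huv => ?_) hxy
  simp only [Function.comp_apply]
  rw [hs.abs_sub_eq hv hu, abs_of_nonneg (sub_nonneg.2 (hφ huv)), mul_sub]

theorem IsMarkovMap.Icc_subset_image_Icc (hG : IsMarkovMap d τ G)
    (hlow : ∀ a b, a < b → ∃ i ∈ Icc a b, τ i < a) (hhigh : ∀ a b, a < b → ∃ i ∈ Icc a b, b < τ i)
    (hij : i < j) : Icc (d (i - 1)) (d (j + 1)) ⊆ G '' Icc (d i) (d j) := by
  have hmono := hG.isGrid.strictMono.monotone
  have himage : ∀ k ∈ Icc i j, d (τ k) ∈ G '' Icc (d i) (d j) := fun k hk =>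
    ⟨d k, ⟨hmono hk.1, hmono hk.2⟩, hG.map_grid k⟩
  obtain ⟨k, hk, hki⟩ := hlow i j hij
  obtain ⟨l, hl, hjl⟩ := hhigh i j hij
  calc Icc (d (i - 1)) (d (j + 1)) ⊆ Icc (d (τ k)) (d (τ l)) :=
        Icc_subset_Icc (hmono (by omega)) (hmono (by omega))
    _ ⊆ G '' Icc (d i) (d j) := (isPreconnected_Icc.image G hG.continuous.continuousOn).Icc_subset
        (himage k hk) (himage l hl)

section Expanding

variable {L μ : ℝ} (hmesh : ∀ j, d (j + 1) - d j ≤ L) (hμ : 2 < μ)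
  (hexp : ∀ j, ∀ x ∈ piece d j, ∀ y ∈ piece d j, μ * |x - y| ≤ |G x - G y|)
include hmesh hμ hexp

/-- If `φ` were constant on an interval, it would be constant on its iterated images, and one of
these contains a piece. -/
theorem HasSlopeAlong.strictMono (hs : HasSlopeAlong d G φ lam) (hG : IsMarkovMap d τ G)
    (hφ : Monotone φ) (hφd : StrictMono (φ ∘ d)) : StrictMono φ := by
  intro x y hxy
  refine (hφ hxy.le).lt_of_ne fun heq => ?_
  have hconst : ∀ n : ℕ, ∀ z ∈ Icc x y, φ (G^[n] z) = φ (G^[n] x) := by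
    intro n z hz
    induction n with
    | zero => exact ((hφ hz.2).trans heq.ge).antisymm (hφ hz.1)
    | succ n ih =>
      rw [Function.iterate_succ_apply', Function.iterate_succ_apply']
      have := hs.abs_sub_le hG.isGrid hφ (G^[n] z) (G^[n] x)
      rw [ih, sub_self, abs_zero, mul_zero, abs_nonpos_iff] at this
      exact sub_eq_zero.1 this
  obtain ⟨n, j, hj⟩ :=
    hG.isGrid.exists_piece_subset_iterate_image hmesh hG.continuous hμ hexp hxy
  obtain ⟨u, hu, hud⟩ := hj (left_mem_piece hG.isGrid.strictMono.monotone j)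
  obtain ⟨v, hv, hvd⟩ := hj (right_mem_piece hG.isGrid.strictMono.monotone j)
  refine (hφd (lt_add_one j)).ne ?_
  simp only [Function.comp_apply]
  rw [← hud, ← hvd, hconst n u hu, hconst n v hv]

theorem IsSlopeGrid.exists_strictMono_hasSlopeAlong (hD : IsSlopeGrid τ lam D)
    (hG : IsMarkovMap d τ G) {w : ℝ → ℝ} {r : ℝ} (hw : Continuous w)
    (hwG : ∀ x, w (G x) ≤ r * w x) (hr : 0 ≤ r) (hrlam : r < lam)
    (hwD : ∀ j, ∀ x ∈ piece d j, D (j + 1) - D j ≤ w x) :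
    ∃ φ, Continuous φ ∧ StrictMono φ ∧ (∀ j, φ (d j) = D j) ∧ HasSlopeAlong d G φ lam := by
  obtain ⟨φ, hφ, heq⟩ := hD.exists_interpolates_eq hG hw hwG hr hrlam hwD
  have hs := hφ.hasSlopeAlong hG (hr.trans_lt hrlam) heq
  refine ⟨φ, hφ.continuous, hs.strictMono hmesh hμ hexp hG hφ.monotone ?_, hφ.apply_grid, hs⟩
  simpa only [Function.comp_def, hφ.apply_grid] using hD.strictMono

theorem IsMarkovMap.isTopologicallyMixing (hG : IsMarkovMap d τ G)
    (hlow : ∀ a b, a < b → ∃ i ∈ Icc a b, τ i < a) (hhigh : ∀ a b, a < b → ∃ i ∈ Icc a b, b < τ i) :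
    IsTopologicallyMixing G := by
  rintro U V hU ⟨u, hu⟩ - ⟨v, hv⟩
  obtain ⟨ε, hε, hsub⟩ := Metric.nhds_basis_closedBall.mem_iff.1 (hU.mem_nhds hu)
  rw [Real.closedBall_eq_Icc] at hsub
  obtain ⟨n, j, hj⟩ := hG.isGrid.exists_piece_subset_iterate_image hmesh hG.continuous hμ hexp
    (by linarith : u - ε < u + ε)
  have hgrow : ∀ m : ℕ, Icc (d (j - m)) (d (j + 1 + m)) ⊆ G^[n + m] '' U := by
    intro m
    induction m with
    | zero => simpa using hj.trans (image_mono hsub)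
    | succ m ih =>
      rw [← add_assoc, Function.iterate_succ', image_comp]
      refine Subset.trans ?_ (image_mono ih)
      have := hG.Icc_subset_image_Icc hlow hhigh (show j - m < j + 1 + m by omega)
      convert this using 3 <;> push_cast <;> ring
  refine ⟨n + (gridIndex d v - j).natAbs, fun N hN => ?_⟩
  obtain ⟨m, rfl⟩ := Nat.exists_eq_add_of_le hN
  have hmono := hG.isGrid.strictMono.monotone
  have hv' := hG.isGrid.mem_piece_gridIndex v
  rw [add_assoc]
  exact ⟨v, hgrow _ ⟨(hmono (by omega)).trans hv'.1, hv'.2.trans (hmono (by omega))⟩, hv⟩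

end Expanding

end Markov

theorem IsTopologicallyMixing.of_semiconj {X Y : Type*} [TopologicalSpace X] [TopologicalSpace Y]
    {f : X → X} {g : Y → Y} {p : X → Y} (hf : IsTopologicallyMixing f) (hp : Continuous p)
    (hdense : DenseRange p) (hfg : Function.Semiconj p f g) : IsTopologicallyMixing g := by
  intro U V hU hUne hV hVne
  obtain ⟨n₀, hn₀⟩ := hf (p ⁻¹' U) (p ⁻¹' V) (hU.preimage hp) (hdense.exists_mem_open hU hUne)
    (hV.preimage hp) (hdense.exists_mem_open hV hVne)
  refine ⟨n₀, fun n hn => ?_⟩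
  obtain ⟨_, ⟨x, hx, rfl⟩, hxV⟩ := hn₀ n hn
  exact ⟨p (f^[n] x), ⟨p x, hx, ((hfg.iterate_right n) x).symm⟩, hxV⟩

/-! ### Maps of the extended line -/

theorem exists_orderIso_of_range_eq_Ioo {α : Type*} [LinearOrder α] {a b : α} {p : ℝ → α}
    (hp : StrictMono p) (hrange : range p = Ioo a b) :
    ∃ e : EReal ≃o Icc a b, ∀ y : ℝ, (e y : α) = p y := by
  have hmem : ∀ y, p y ∈ Ioo a b := fun y => hrange ▸ mem_range_self y
  have hab : a < b := (hmem 0).1.trans (hmem 0).2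
  let e : EReal → Icc a b := EReal.rec ⟨a, left_mem_Icc.2 hab.le⟩
    (fun y => ⟨p y, Ioo_subset_Icc_self (hmem y)⟩) ⟨b, right_mem_Icc.2 hab.le⟩
  have hmono : StrictMono e := by
    intro x y hxy
    induction x <;> induction y
    case coe.coe => exact hp (EReal.coe_lt_coe_iff.1 hxy)
    case bot.coe => exact (hmem _).1
    case coe.top => exact (hmem _).2
    case bot.top => exact hab
    all_goals simp at hxy
  have hsurj : Function.Surjective e := by
    rintro ⟨x, hx⟩
    rcases hx.1.eq_or_lt with rfl | ha
    · exact ⟨⊥, rfl⟩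
    rcases hx.2.eq_or_lt with rfl | hb
    · exact ⟨⊤, rfl⟩
    obtain ⟨y, rfl⟩ := hrange.ge ⟨ha, hb⟩
    exact ⟨y, rfl⟩
  exact ⟨hmono.orderIsoOfSurjective e hsurj, fun y => rfl⟩

theorem range_eq_Ioo_of_tendsto {α : Type*} [LinearOrder α] [TopologicalSpace α] [OrderTopology α]
    {a b : α} {p : ℝ → α} {d : ℤ → ℝ} (hd : IsGrid d) (hp : StrictMono p) (hcont : Continuous p)
    (hbot : Tendsto (p ∘ d) atBot (𝓝 a)) (htop : Tendsto (p ∘ d) atTop (𝓝 b)) :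
    range p = Ioo a b := by
  have hmono : Monotone (p ∘ d) := hp.monotone.comp hd.strictMono.monotone
  ext y
  constructor
  · rintro ⟨x, rfl⟩
    obtain ⟨i, hi⟩ := (hd.tendsto_atBot.eventually_lt_atBot x).exists
    obtain ⟨j, hj⟩ := (hd.tendsto_atTop.eventually_gt_atTop x).exists
    exact ⟨(hmono.le_of_tendsto hbot i).trans_lt (hp hi),
      (hp hj).trans_le (hmono.ge_of_tendsto htop j)⟩
  · rintro ⟨ha, hb⟩
    obtain ⟨i, hi⟩ := (hbot.eventually_lt_const ha).exists
    obtain ⟨j, hj⟩ := (htop.eventually_const_lt hb).exists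
    exact mem_range_of_exists_le_of_exists_ge hcont ⟨_, hi.le⟩ ⟨_, hj.le⟩

/-- The extension of a self-map of the line to the extended line that fixes both infinities. -/
noncomputable def extendEReal (G : ℝ → ℝ) : EReal → EReal := EReal.rec ⊥ (fun x => G x) ⊤

theorem continuous_extendEReal {G : ℝ → ℝ} (hG : Continuous G) (hbot : Tendsto G atBot atBot)
    (htop : Tendsto G atTop atTop) : Continuous (extendEReal G) := by
  refine continuous_iff_continuousAt.2 fun x => ?_
  induction x with
  | bot =>
    rw [continuousAt_iff_punctured_nhds, EReal.nhdsWithin_bot, tendsto_map'_iff]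
    exact EReal.tendsto_coe_nhds_bot_iff.2 hbot
  | coe x =>
    rw [← EReal.isOpenEmbedding_coe.continuousAt_iff]
    exact (continuous_coe_real_ereal.comp hG).continuousAt
  | top =>
    rw [continuousAt_iff_punctured_nhds, EReal.nhdsWithin_top, tendsto_map'_iff]
    exact EReal.tendsto_coe_nhds_top_iff.2 htop

theorem basicIntervals_eq_range {X ι : Type*} [TopologicalSpace X] {P : Set X} {J : ι → Set X}
    (hopen : ∀ i, IsOpen (J i)) (hconn : ∀ i, IsPreconnected (J i)) (hne : ∀ i, (J i).Nonempty)
    (hdisj : Pairwise (Function.onFun Disjoint J)) (hP : Pᶜ = ⋃ i, J i) :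
    basicIntervals P = range J := by
  have hsub : ∀ i, J i ⊆ Pᶜ := fun i => hP ▸ subset_iUnion J i
  have hcomp : ∀ i, ∀ x ∈ J i, connectedComponentIn Pᶜ x = J i := by
    intro i x hx
    refine Subset.antisymm ?_ ((hconn i).subset_connectedComponentIn hx (hsub i))
    refine isPreconnected_connectedComponentIn.subset_left_of_subset_union (hopen i)
      (isOpen_iUnion fun j : {j // j ≠ i} => hopen j)
      (disjoint_iUnion_right.2 fun j => hdisj j.2.symm) ?_
      ⟨x, mem_connectedComponentIn (hsub i hx), hx⟩
    refine (connectedComponentIn_subset _ _).trans fun y hy => ?_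
    obtain ⟨j, hj⟩ := mem_iUnion.1 (hP ▸ hy)
    by_cases hji : j = i
    · exact Or.inl (hji ▸ hj)
    · exact Or.inr (mem_iUnion.2 ⟨⟨j, hji⟩, hj⟩)
  ext I
  constructor
  · rintro ⟨x, hx, rfl⟩
    obtain ⟨i, hi⟩ := mem_iUnion.1 (hP ▸ hx)
    exact ⟨i, (hcomp i x hi).symm⟩
  · rintro ⟨i, rfl⟩
    obtain ⟨x, hx⟩ := hne i
    exact ⟨x, hsub i hx, (hcomp i x hx).symm⟩

section Extension

variable {X : Type*} [LinearOrder X]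

/-- The self-map of a copy `X` of the extended line that extends the self-map `G` of the line. -/
noncomputable def extension (e : EReal ≃o X) (G : ℝ → ℝ) : X → X := e ∘ extendEReal G ∘ e.symm

/-- The partition set of `extension e G`: the endpoints of `X` and the grid `d`. -/
def extendedGrid (e : EReal ≃o X) (d : ℤ → ℝ) : Set X := e '' {⊥, ⊤} ∪ range fun j => e (d j)

/-- The interior of the `j`-th piece of the grid `d`, as a subset of a copy `X` of the extended
line. -/
def cell (e : EReal ≃o X) (d : ℤ → ℝ) (j : ℤ) : Set X :=
  (fun y : ℝ => e y) '' Ioo (d j) (d (j + 1))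

variable {e : EReal ≃o X} {d : ℤ → ℝ} {τ : ℤ → ℤ} {G : ℝ → ℝ} {i j : ℤ}

theorem extension_bot (e : EReal ≃o X) (G : ℝ → ℝ) : extension e G (e ⊥) = e ⊥ := by
  simp [extension, extendEReal]

theorem extension_top (e : EReal ≃o X) (G : ℝ → ℝ) : extension e G (e ⊤) = e ⊤ := by
  simp [extension, extendEReal]

theorem extension_coe (e : EReal ≃o X) (G : ℝ → ℝ) (y : ℝ) : extension e G (e y) = e (G y) := by
  simp [extension, extendEReal]

theorem strictMono_coe (e : EReal ≃o X) : StrictMono fun y : ℝ => e y :=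
  e.strictMono.comp EReal.coe_strictMono

theorem compl_extendedGrid (hd : IsGrid d) : (extendedGrid e d)ᶜ = ⋃ j, cell e d j := by
  refine Subset.antisymm (fun x hx => ?_) (iUnion_subset fun j => ?_)
  · obtain ⟨y, rfl⟩ := e.surjective x
    induction y with
    | bot => exact absurd (Or.inl ⟨⊥, by simp⟩) hx
    | top => exact absurd (Or.inl ⟨⊤, by simp⟩) hx
    | coe y =>
      have hy := hd.mem_Ico_gridIndex y
      have hne : d (gridIndex d y) ≠ y := fun heq =>
        hx (Or.inr ⟨_, congrArg (fun z : ℝ => e z) heq⟩)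
      exact mem_iUnion.2 ⟨_, mem_image_of_mem _ ⟨hy.1.lt_of_ne hne, hy.2⟩⟩
  · rintro _ ⟨y, hy, rfl⟩ (⟨z, hz, hzy⟩ | ⟨i, hi⟩)
    · rw [e.injective hzy] at hz
      simp at hz
    · rw [← (strictMono_coe e).injective hi, mem_Ioo, hd.strictMono.lt_iff_lt,
        hd.strictMono.lt_iff_lt] at hy
      omega

theorem cell_nonempty (e : EReal ≃o X) (hd : IsGrid d) (j : ℤ) : (cell e d j).Nonempty :=
  (nonempty_Ioo.2 (hd.lt_succ j)).image _

theorem disjoint_cell (e : EReal ≃o X) (hd : IsGrid d) :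
    Pairwise (Function.onFun Disjoint (cell e d)) := by
  refine fun i j hij => (disjoint_image_iff (strictMono_coe e).injective).2
    (disjoint_left.2 fun y hi hj => hij ?_)
  rw [← hd.gridIndex_eq (Ioo_subset_Ico_self hi), ← hd.gridIndex_eq (Ioo_subset_Ico_self hj)]

theorem monotoneOn_or_antitoneOn_cell (hG : IsMarkovMap d τ G) (j : ℤ) :
    MonotoneOn (extension e G) (cell e d j) ∨ AntitoneOn (extension e G) (cell e d j) := by
  refine (hG.strictMonoOn_or_strictAntiOn j).imp (fun h => ?_) (fun h => ?_)
  all_goals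
    rintro _ ⟨x, hx, rfl⟩ _ ⟨y, hy, rfl⟩ hxy
    simp only [extension_coe, e.le_iff_le, EReal.coe_le_coe_iff] at hxy ⊢
  · exact h.monotoneOn (Ioo_subset_Icc_self hx) (Ioo_subset_Icc_self hy) hxy
  · exact h.antitoneOn (Ioo_subset_Icc_self hx) (Ioo_subset_Icc_self hy) hxy

theorem mapsTo_extendedGrid (e : EReal ≃o X) (hG : IsMarkovMap d τ G) :
    MapsTo (extension e G) (extendedGrid e d) (extendedGrid e d) := by
  rintro _ (⟨_, rfl | rfl, rfl⟩ | ⟨j, rfl⟩)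
  · rw [extension_bot]
    exact Or.inl ⟨⊥, by simp⟩
  · rw [extension_top]
    exact Or.inl ⟨⊤, by simp⟩
  · rw [extension_coe, hG.map_grid]
    exact Or.inr ⟨τ j, rfl⟩

theorem cell_subset_image_iff (hG : IsMarkovMap d τ G) :
    cell e d j ⊆ extension e G '' cell e d i ↔ j ∈ coveredPieces τ i := by
  rw [← hG.Ioo_subset_image_Ioo_iff, cell, cell, image_image]
  simp only [extension_coe]
  rw [← image_image (fun y : ℝ => e y) G, image_subset_image_iff (strictMono_coe e).injective]

variable [TopologicalSpace X] [OrderTopology X]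

theorem isOpenEmbedding_coe (e : EReal ≃o X) : Topology.IsOpenEmbedding fun y : ℝ => e y :=
  e.toHomeomorph.isOpenEmbedding.comp EReal.isOpenEmbedding_coe

theorem denseRange_coe (e : EReal ≃o X) : DenseRange fun y : ℝ => e y :=
  e.surjective.denseRange.comp
    (EReal.denseRange_ratCast.mono (range_comp_subset_range (Rat.cast : ℚ → ℝ) Real.toEReal))
    e.continuous

theorem basicIntervals_extendedGrid (e : EReal ≃o X) (hd : IsGrid d) :
    basicIntervals (extendedGrid e d) = range (cell e d) :=
  basicIntervals_eq_range (fun _ => (isOpenEmbedding_coe e).isOpenMap _ isOpen_Ioo)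
    (fun _ => isPreconnected_Ioo.image _ (isOpenEmbedding_coe e).continuous.continuousOn)
    (cell_nonempty e hd) (disjoint_cell e hd) (compl_extendedGrid hd)

end Extension

theorem isCPMM_extension {α : Type*} [LinearOrder α] [TopologicalSpace α] [OrderTopology α]
    {a b : α} {d : ℤ → ℝ} {τ : ℤ → ℤ} {G : ℝ → ℝ} (e : EReal ≃o Icc a b) (hG : IsMarkovMap d τ G)
    (hbot : Tendsto G atBot atBot) (htop : Tendsto G atTop atTop) :
    IsCPMM (extension e G) (extendedGrid e d) where
  lt := (e ⊥).2.1.trans_lt ((Subtype.coe_lt_coe.2 (e.strictMono bot_lt_top)).trans_le (e ⊤).2.2)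
  continuous := e.continuous.comp
    ((continuous_extendEReal hG.continuous hbot htop).comp e.symm.continuous)
  isClosed := by
    rw [← isOpen_compl_iff, compl_extendedGrid hG.isGrid]
    exact isOpen_iUnion fun _ => (isOpenEmbedding_coe e).isOpenMap _ isOpen_Ioo
  countable := ((toFinite _).image e).countable.union (countable_range _)
  endpoints_mem x hx := by
    obtain ⟨y, rfl⟩ := e.surjective x
    refine Or.inl (mem_image_of_mem e ?_)
    rcases hx with hx | hx
    · exact Or.inl (isMin_iff_eq_bot.1 ((e.isMin_apply).1 fun z _ => hx.trans_le z.2.1))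
    · exact Or.inr (isMax_iff_eq_top.1 ((e.isMax_apply).1 fun z _ => z.2.2.trans hx.ge))
  mapsTo := mapsTo_extendedGrid e hG
  monotone I hI := by
    rw [basicIntervals_extendedGrid e hG.isGrid] at hI
    obtain ⟨j, rfl⟩ := hI
    exact monotoneOn_or_antitoneOn_cell hG j

theorem isTopologicallyMixing_extension {X : Type*} [LinearOrder X] [TopologicalSpace X]
    [OrderTopology X] (e : EReal ≃o X) {G : ℝ → ℝ} (hG : IsTopologicallyMixing G) :
    IsTopologicallyMixing (extension e G) :=
  hG.of_semiconj (isOpenEmbedding_coe e).continuous (denseRange_coe e)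
    fun y => (extension_coe e G y).symm

section ConstantSlopeModel

variable {d : ℤ → ℝ} {τ : ℤ → ℤ} {G φ : ℝ → ℝ} {lam : ℝ} {a b : EReal}

theorem hasConstantSlope_extension (e : EReal ≃o Icc a b) (heφ : ∀ y : ℝ, (e y : EReal) = φ y)
    (hG : IsMarkovMap d τ G) (hbot : Tendsto G atBot atBot) (htop : Tendsto G atTop atTop)
    (hs : HasSlopeAlong d G φ lam) : HasConstantSlope (extension e G) lam := by
  refine ⟨extendedGrid e d, isCPMM_extension e hG hbot htop, fun I hI => ?_⟩
  rw [basicIntervals_extendedGrid e hG.isGrid] at hI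
  obtain ⟨j, rfl⟩ := hI
  obtain ⟨s, c, hslope, hsc⟩ := hs j
  refine ⟨s, c, hslope, ?_⟩
  rintro _ ⟨y, hy, rfl⟩
  rw [extension_coe, heφ, heφ, EReal.toReal_coe, hsc y (Ioo_subset_Icc_self hy)]

theorem isConjugateToConstantSlope_extension {X : Type*} [LinearOrder X] [TopologicalSpace X]
    [OrderTopology X] (e : EReal ≃o X) (hG : IsMarkovMap d τ G) (hbot : Tendsto G atBot atBot)
    (htop : Tendsto G atTop atTop) (hφ : StrictMono φ) (hcont : Continuous φ)
    (hs : HasSlopeAlong d G φ lam) (ha : Tendsto (fun j => (φ (d j) : EReal)) atBot (𝓝 a))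
    (hb : Tendsto (fun j => (φ (d j) : EReal)) atTop (𝓝 b)) :
    IsConjugateToConstantSlope (extension e G) a b lam := by
  obtain ⟨e', he'⟩ := exists_orderIso_of_range_eq_Ioo (EReal.coe_strictMono.comp hφ)
    (range_eq_Ioo_of_tendsto hG.isGrid (EReal.coe_strictMono.comp hφ)
      (continuous_coe_real_ereal.comp hcont) ha hb)
  refine ⟨(e.symm.trans e').toHomeomorph, extension e' G, (e.symm.trans e').strictMono, fun x => ?_,
    hasConstantSlope_extension e' he' hG hbot htop hs⟩
  simp [extension]

end ConstantSlopeModel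

/-! ### The map `F` -/

theorem dotB_sq : dotB * dotB = 1 - dotB := by
  have h : √5 * √5 = 5 := Real.mul_self_sqrt (by norm_num)
  unfold dotB
  linear_combination h / 4

theorem two_lt_sqrt_five : 2 < √5 := by
  rw [Real.lt_sqrt] <;> norm_num

theorem sqrt_five_eq : √5 = 2 * dotB + 1 := by
  unfold dotB
  ring

theorem dotB_pos : 0 < dotB := by
  linarith [two_lt_sqrt_five, sqrt_five_eq]

theorem dotB_lt_one : dotB < 1 := by
  nlinarith [dotB_sq, dotB_pos]

theorem mapF_left {k : ℤ} {x : ℝ} (hx : x ∈ Icc (k : ℝ) (k + dotB)) :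
    mapF x = k - 1 + (2 + √5) * (x - k) := by
  have hfloor : ⌊x⌋ = k := Int.floor_eq_iff.2 ⟨hx.1, by linarith [hx.2, dotB_lt_one]⟩
  have hfract : Int.fract x = x - k := by rw [Int.fract, hfloor]
  have hb := dotB_pos.ne'
  rw [mapF, hfract, hfloor, if_pos (by linarith [hx.2]), AffineMap.lineMap_apply, sqrt_five_eq]
  simp only [vsub_eq_sub, vadd_eq_add, smul_eq_mul]
  field_simp
  linear_combination (-(2 * (x - k))) * dotB_sq

theorem mapF_right {k : ℤ} {x : ℝ} (hx : x ∈ Icc ((k : ℝ) + dotB) (k + 1)) :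
    mapF x = k + dotB + 1 - (2 + √5) * (x - (k + dotB)) := by
  have hb := dotB_pos
  have hb1 : 1 - dotB ≠ 0 := by linarith [dotB_lt_one]
  rcases hx.1.eq_or_lt with h0 | h0
  · rw [mapF_left (k := k) (by rw [← h0]; constructor <;> linarith), ← h0, sqrt_five_eq]
    linear_combination 2 * dotB_sq
  rcases hx.2.eq_or_lt with h1 | h1
  · rw [mapF_left (k := k + 1) (by rw [h1]; push_cast; constructor <;> linarith), h1, sqrt_five_eq]
    push_cast
    linear_combination (-2) * dotB_sq
  have hfloor : ⌊x⌋ = k := Int.floor_eq_iff.2 ⟨by linarith, h1⟩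
  have hfract : Int.fract x = x - k := by rw [Int.fract, hfloor]
  rw [mapF, hfract, hfloor, if_neg (by linarith), AffineMap.lineMap_apply, sqrt_five_eq]
  simp only [vsub_eq_sub, vadd_eq_add, smul_eq_mul]
  field_simp
  linear_combination (-2 * (x - k - dotB)) * dotB_sq

theorem exists_mem_Icc_left_or_right (x : ℝ) :
    ∃ k : ℤ, x ∈ Icc (k : ℝ) (k + dotB) ∨ x ∈ Icc ((k : ℝ) + dotB) (k + 1) :=
  ⟨⌊x⌋, (le_total x (⌊x⌋ + dotB)).imp (fun h => ⟨Int.floor_le x, h⟩)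
    fun h => ⟨h, (Int.lt_floor_add_one x).le⟩⟩

theorem mapF_dotB_sub (x : ℝ) : mapF (dotB - x) = dotB - mapF x := by
  have hsq := dotB_sq
  obtain ⟨k, hx | hx⟩ := exists_mem_Icc_left_or_right x
  · have hx' : dotB - x ∈ Icc ((-k : ℤ) : ℝ) ((-k : ℤ) + dotB) := by
      push_cast
      constructor <;> linarith [hx.1, hx.2]
    rw [mapF_left hx', mapF_left hx, sqrt_five_eq]
    push_cast
    linear_combination 2 * hsq
  · have hx' : dotB - x ∈ Icc (((-k - 1 : ℤ) : ℝ) + dotB) ((-k - 1 : ℤ) + 1) := by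
      push_cast
      constructor <;> linarith [hx.1, hx.2]
    rw [mapF_right hx', mapF_right hx, sqrt_five_eq]
    push_cast
    linear_combination 2 * hsq

theorem mapF_le_add_one (x : ℝ) : mapF x ≤ x + 1 := by
  have h5 := two_lt_sqrt_five
  obtain ⟨k, hx | hx⟩ := exists_mem_Icc_left_or_right x
  · rw [mapF_left hx, sqrt_five_eq]
    nlinarith [dotB_sq, hx.1, hx.2, dotB_pos]
  · rw [mapF_right hx]
    nlinarith [hx.1, hx.2]

theorem sub_one_le_mapF (x : ℝ) : x - 1 ≤ mapF x := by
  have h := mapF_le_add_one (dotB - x)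
  rw [mapF_dotB_sub] at h
  linarith

theorem tendsto_mapF_atBot : Tendsto mapF atBot atBot :=
  tendsto_atBot_mono mapF_le_add_one (tendsto_atBot_add_const_right _ 1 tendsto_id)

theorem tendsto_mapF_atTop : Tendsto mapF atTop atTop :=
  tendsto_atTop_mono sub_one_le_mapF (tendsto_atTop_add_const_right _ (-1) tendsto_id)

/-- The increasing enumeration of the first coordinates `k`, `k + b` of the dots. -/
noncomputable def dot : ℤ → ℝ := interleave (fun k => k) (fun k => k + dotB)

/-- The action of `F` on the indices of the dots. -/
def dotMap (j : ℤ) : ℤ := if Even j then j - 2 else j + 2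

theorem dot_even (k : ℤ) : dot (2 * k) = k := interleave_even _ _ k

theorem dot_odd (k : ℤ) : dot (2 * k + 1) = k + dotB := interleave_odd _ _ k

theorem dot_odd_add_one (k : ℤ) : dot (2 * k + 1 + 1) = k + 1 := by
  rw [dot, interleave_odd_add_one, Int.cast_add, Int.cast_one]

theorem dotMap_even (k : ℤ) : dotMap (2 * k) = 2 * (k - 1) := by
  rw [dotMap, if_pos (even_two_mul k)]
  ring

theorem dotMap_odd (k : ℤ) : dotMap (2 * k + 1) = 2 * (k + 1) + 1 := by
  rw [dotMap, if_neg (Int.not_even_two_mul_add_one k)]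
  ring

theorem dotB_sub_dot (j : ℤ) : dotB - dot j = dot (1 - j) := by
  obtain ⟨k, rfl | rfl⟩ := Int.even_or_odd' j
  · rw [show 1 - 2 * k = 2 * (-k) + 1 by ring, dot_even, dot_odd]
    push_cast
    ring
  · rw [show 1 - (2 * k + 1) = 2 * (-k) by ring, dot_even, dot_odd]
    push_cast
    ring

theorem isGrid_dot : IsGrid dot where
  strictMono := interleave_strictMono (fun k => by linarith [dotB_pos])
    fun k => by push_cast; linarith [dotB_lt_one]
  tendsto_atTop := interleave_tendsto_atTop tendsto_intCast_atTop_atTop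
    (tendsto_atTop_add_const_right _ _ tendsto_intCast_atTop_atTop)
  tendsto_atBot :=
    have hcast : Tendsto (Int.cast : ℤ → ℝ) atBot atBot := tendsto_intCast_atBot_iff.2 tendsto_id
    interleave_tendsto_atBot hcast (tendsto_atBot_add_const_right _ _ hcast)

theorem dot_add_one_sub_le_one (j : ℤ) : dot (j + 1) - dot j ≤ 1 := by
  obtain ⟨k, rfl | rfl⟩ := Int.even_or_odd' j
  · rw [dot_even, dot_odd]
    linarith [dotB_lt_one]
  · rw [dot_odd, dot_odd_add_one]
    linarith [dotB_pos]

theorem mapF_dot (j : ℤ) : mapF (dot j) = dot (dotMap j) := by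
  obtain ⟨k, rfl | rfl⟩ := Int.even_or_odd' j
  · rw [dotMap_even, dot_even, dot_even, mapF_left ⟨le_rfl, by linarith [dotB_pos]⟩]
    push_cast
    ring
  · rw [dotMap_odd, dot_odd, dot_odd, mapF_right ⟨le_rfl, by linarith [dotB_lt_one]⟩]
    push_cast
    ring

theorem hasSlopeAlong_id_mapF : HasSlopeAlong dot mapF id (2 + √5) := by
  have hpos : (0 : ℝ) ≤ 2 + √5 := by positivity
  intro j
  obtain ⟨k, rfl | rfl⟩ := Int.even_or_odd' j
  · refine ⟨2 + √5, k - 1 - (2 + √5) * k, abs_of_nonneg hpos, fun x hx => ?_⟩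
    rw [piece, dot_even, dot_odd] at hx
    rw [id, id, mapF_left hx]
    ring
  · refine ⟨-(2 + √5), k + dotB + 1 + (2 + √5) * (k + dotB), by rw [abs_neg, abs_of_nonneg hpos],
      fun x hx => ?_⟩
    rw [piece, dot_odd, dot_odd_add_one] at hx
    rw [id, id, mapF_right hx]
    ring

theorem abs_mapF_sub_mapF (j : ℤ) (x : ℝ) (hx : x ∈ piece dot j) (y : ℝ) (hy : y ∈ piece dot j) :
    |mapF x - mapF y| = (2 + √5) * |x - y| :=
  hasSlopeAlong_id_mapF.abs_sub_eq hx hy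

theorem isMarkovMap_mapF : IsMarkovMap dot dotMap mapF where
  isGrid := isGrid_dot
  continuous := isGrid_dot.continuous_of_continuousOn_piece fun j => by
    obtain ⟨s, c, -, hsc⟩ := hasSlopeAlong_id_mapF j
    exact (by fun_prop : Continuous fun x : ℝ => s * x + c).continuousOn.congr hsc
  map_grid := mapF_dot
  injOn j x hx y hy hxy := by
    have h := abs_mapF_sub_mapF j x hx y hy
    rw [hxy, sub_self, abs_zero, eq_comm, mul_eq_zero_iff_left (by positivity)] at h
    exact sub_eq_zero.1 (abs_eq_zero.1 h)

theorem exists_dotMap_lt {a b : ℤ} (hab : a < b) : ∃ i ∈ Icc a b, dotMap i < a := by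
  obtain ⟨k, rfl | rfl⟩ := Int.even_or_odd' a
  · exact ⟨2 * k, ⟨le_rfl, hab.le⟩, by rw [dotMap_even]; omega⟩
  · exact ⟨2 * (k + 1), ⟨by omega, by omega⟩, by rw [dotMap_even]; omega⟩

theorem exists_lt_dotMap {a b : ℤ} (hab : a < b) : ∃ i ∈ Icc a b, b < dotMap i := by
  obtain ⟨k, rfl | rfl⟩ := Int.even_or_odd' b
  · exact ⟨2 * (k - 1) + 1, ⟨by omega, by omega⟩, by rw [dotMap_odd]; omega⟩
  · exact ⟨2 * k + 1, ⟨hab.le, le_rfl⟩, by rw [dotMap_odd]; omega⟩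

theorem isTopologicallyMixing_mapF : IsTopologicallyMixing mapF :=
  isMarkovMap_mapF.isTopologicallyMixing dot_add_one_sub_le_one
    (by linarith [two_lt_sqrt_five] : 2 < 2 + √5)
    (fun j x hx y hy => (abs_mapF_sub_mapF j x hx y hy).ge)
    (fun _ _ => exists_dotMap_lt) fun _ _ => exists_lt_dotMap

/-! ### The map `f` -/

section Interval

variable {h : Ioo (0 : ℝ) 1 ≃ₜ ℝ}

theorem mapf_symm (h : Ioo (0 : ℝ) 1 ≃ₜ ℝ) (y : ℝ) :
    mapf h ⟨h.symm y, Ioo_subset_Icc_self (h.symm y).2⟩ =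
      ⟨h.symm (mapF y), Ioo_subset_Icc_self (h.symm (mapF y)).2⟩ := by
  rw [mapf, dif_pos (h.symm y).2]
  simp only [Subtype.coe_eta, Homeomorph.apply_symm_apply]

theorem mem_partitionP {x : Icc (0 : ℝ) 1} :
    x ∈ partitionP h ↔ (x : ℝ) = 0 ∨ (x : ℝ) = 1 ∨ ∃ j, (x : ℝ) = h.symm (dot j) := by
  refine or_congr_right (or_congr_right ⟨?_, ?_⟩)
  · rintro ⟨k, hk | hk⟩
    · exact ⟨2 * k, by rw [hk, dot_even]⟩
    · exact ⟨2 * k + 1, by rw [hk, dot_odd]⟩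
  · rintro ⟨j, hj⟩
    obtain ⟨k, rfl | rfl⟩ := Int.even_or_odd' j
    · exact ⟨k, Or.inl (by rw [hj, dot_even])⟩
    · exact ⟨k, Or.inr (by rw [hj, dot_odd])⟩

theorem trans_subLeft_symm_apply (h : Ioo (0 : ℝ) 1 ≃ₜ ℝ) (y : ℝ) :
    (h.trans (Homeomorph.subLeft dotB)).symm y = h.symm (dotB - y) := by
  simp [neg_add_eq_sub]

theorem mapf_trans_subLeft (h : Ioo (0 : ℝ) 1 ≃ₜ ℝ) :
    mapf (h.trans (Homeomorph.subLeft dotB)) = mapf h := by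
  funext x
  unfold mapf
  split_ifs
  · simp only [trans_subLeft_symm_apply, Homeomorph.trans_apply, Homeomorph.subLeft_apply,
      mapF_dotB_sub, sub_sub_cancel]
  · rfl

theorem partitionP_trans_subLeft (h : Ioo (0 : ℝ) 1 ≃ₜ ℝ) :
    partitionP (h.trans (Homeomorph.subLeft dotB)) = partitionP h := by
  ext x
  rw [mem_partitionP, mem_partitionP]
  simp only [trans_subLeft_symm_apply, dotB_sub_dot]
  rw [(Equiv.subLeft (1 : ℤ)).exists_congr_left (p := fun j => (x : ℝ) = h.symm (dot (1 - j)))]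
  simp only [Equiv.subLeft_symm_apply, neg_add_eq_sub, sub_sub_cancel]

theorem exists_orderIso_mapf_of_strictMono (hh : StrictMono h.symm) :
    ∃ e : EReal ≃o Icc (0 : ℝ) 1,
      mapf h = extension e mapF ∧ partitionP h = extendedGrid e dot := by
  have hrange : range (fun y => (h.symm y : ℝ)) = Ioo 0 1 := by
    rw [range_comp' Subtype.val, h.symm.surjective.range_eq, image_univ, Subtype.range_coe]
  obtain ⟨e, he⟩ := exists_orderIso_of_range_eq_Ioo (p := fun y => (h.symm y : ℝ))
    (fun _ _ hxy => hh hxy) hrange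
  have hcoe : ∀ y : ℝ, e y = ⟨h.symm y, Ioo_subset_Icc_self (h.symm y).2⟩ := fun y =>
    Subtype.ext (he y)
  have hbot : e ⊥ = ⟨0, by simp⟩ := le_antisymm (e.le_symm_apply.1 bot_le) (e ⊥).2.1
  have htop : e ⊤ = ⟨1, by simp⟩ := le_antisymm (e ⊤).2.2 (e.symm_apply_le.1 le_top)
  refine ⟨e, ?_, ?_⟩
  · rw [← e.surjective.right_cancellable]
    funext x
    simp only [Function.comp_apply]
    induction x with
    | bot => rw [extension_bot, hbot, mapf, dif_neg (by simp)]
    | coe y => rw [extension_coe, hcoe, hcoe, mapf_symm]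
    | top => rw [extension_top, htop, mapf, dif_neg (by simp)]
  · ext x
    simp only [mem_partitionP, extendedGrid, image_pair, hbot, htop, hcoe, mem_union,
      mem_insert_iff, mem_singleton_iff, mem_range, Subtype.ext_iff, or_assoc, eq_comm]

theorem exists_orderIso_mapf (h : Ioo (0 : ℝ) 1 ≃ₜ ℝ) :
    ∃ e : EReal ≃o Icc (0 : ℝ) 1,
      mapf h = extension e mapF ∧ partitionP h = extendedGrid e dot := by
  rcases h.symm.continuous.strictMono_of_inj h.symm.injective with hh | hh
  · exact exists_orderIso_mapf_of_strictMono hh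
  · rw [← mapf_trans_subLeft, ← partitionP_trans_subLeft]
    refine exists_orderIso_mapf_of_strictMono fun x y hxy => ?_
    rw [trans_subLeft_symm_apply, trans_subLeft_symm_apply]
    exact hh (sub_lt_sub_left hxy _)

end Interval

/-! ### Slope grids of `F` -/

theorem two_mul_le_iff_two_add_sqrt_five_le {lam : ℝ} (hlam : 0 < lam) :
    2 * lam ≤ lam * lam - 2 * lam - 1 ↔ 2 + √5 ≤ lam := by
  have h5 : √5 * √5 = 5 := Real.mul_self_sqrt (by norm_num)
  constructor <;> intro h <;> nlinarith [two_lt_sqrt_five]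

theorem exists_geomGrid_ratio {lam : ℝ} (h : 2 + √5 < lam) :
    ∃ t, 1 < t ∧ t < lam ∧ lam * (t * t + 1) = t * (lam * lam - 2 * lam - 1) := by
  have hlam : 1 < lam := by linarith [two_lt_sqrt_five]
  have h5 : √5 * √5 = 5 := Real.mul_self_sqrt (by norm_num)
  let p : ℝ → ℝ := fun t => t * (lam * lam - 2 * lam - 1) - lam * (t * t + 1)
  have hone : 0 < p 1 := by
    simp only [p]
    nlinarith [two_lt_sqrt_five]
  have hlam_neg : p lam < 0 := by
    simp only [p]
    nlinarith
  obtain ⟨t, ht, hpt⟩ := intermediate_value_Ioo' hlam.le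
    (by fun_prop : Continuous p).continuousOn ⟨hlam_neg, hone⟩
  exact ⟨t, ht.1, ht.2, (sub_eq_zero.1 hpt).symm⟩

/-- The slope grid of `F` whose increments over the pieces of equal parity are geometric with ratio
`t`; the factors `lam + t` and `lam * t + 1` are forced by the equations at the odd pieces. -/
noncomputable def geomGrid (lam t : ℝ) : ℤ → ℝ :=
  interleave (fun k => t ^ k * (lam + t)) (fun k => t ^ k * (lam * t + 1))

section GeomGrid

variable {lam t : ℝ}

theorem geomGrid_even (lam t : ℝ) (k : ℤ) : geomGrid lam t (2 * k) = t ^ k * (lam + t) :=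
  interleave_even _ _ k

theorem geomGrid_odd (lam t : ℝ) (k : ℤ) : geomGrid lam t (2 * k + 1) = t ^ k * (lam * t + 1) :=
  interleave_odd _ _ k

theorem geomGrid_odd_add_one (ht : t ≠ 0) (k : ℤ) :
    geomGrid lam t (2 * k + 1 + 1) = t ^ k * (t * (lam + t)) := by
  rw [geomGrid, interleave_odd_add_one, zpow_add_one₀ ht, mul_assoc]

theorem geomGrid_strictMono (hlam : 1 < lam) (ht : 1 < t) : StrictMono (geomGrid lam t) := by
  refine interleave_strictMono (fun k => ?_) (fun k => ?_)
  · gcongr ?_ * ?_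
    nlinarith
  · rw [zpow_add_one₀ (by positivity), mul_assoc]
    gcongr ?_ * ?_
    nlinarith

theorem isSlopeGrid_geomGrid (hlam : 1 < lam) (ht : 1 < t)
    (h : lam * (t * t + 1) = t * (lam * lam - 2 * lam - 1)) :
    IsSlopeGrid dotMap lam (geomGrid lam t) where
  strictMono := geomGrid_strictMono hlam ht
  abs_sub_eq j := by
    have ht0 : t ≠ 0 := by positivity
    have hmono := (geomGrid_strictMono hlam ht).monotone
    obtain ⟨k, rfl | rfl⟩ := Int.even_or_odd' j
    · rw [dotMap_even, dotMap_odd, abs_of_nonneg (sub_nonneg.2 (hmono (by omega))), geomGrid_even,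
        geomGrid_even, geomGrid_odd, geomGrid_odd, zpow_add_one₀ ht0, zpow_sub_one₀ ht0]
      field_simp
      linear_combination (t - 1) * h
    · rw [geomGrid_odd_add_one ht0, geomGrid_odd, dotMap_odd,
        show 2 * k + 1 + 1 = 2 * (k + 1) by ring, dotMap_even, abs_sub_comm,
        abs_of_nonneg (sub_nonneg.2 (hmono (by omega))), geomGrid_even, geomGrid_odd,
        zpow_add_one₀ ht0, add_sub_cancel_right]
      ring

theorem geomGrid_add_one_sub_le (hlam : 1 < lam) (ht : 1 < t) {j : ℤ} {x : ℝ}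
    (hx : x ∈ piece dot j) :
    geomGrid lam t (j + 1) - geomGrid lam t j ≤ t * (lam + t) * t ^ x := by
  have ht0 : 0 < t := by linarith
  have : 0 < t * (lam + t) := mul_pos ht0 (by linarith)
  have hbound : ∀ k : ℤ, (k : ℝ) ≤ x → t ^ k * (t * (lam + t)) ≤ t * (lam + t) * t ^ x :=
    fun k hk => by
      rw [mul_comm, ← Real.rpow_intCast]
      gcongr
      exact ht.le
  obtain ⟨k, rfl | rfl⟩ := Int.even_or_odd' j
  · rw [piece, dot_even, dot_odd] at hx
    rw [geomGrid_even, geomGrid_odd, ← mul_sub]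
    refine le_trans ?_ (hbound k hx.1)
    gcongr
    nlinarith
  · rw [piece, dot_odd, dot_odd_add_one] at hx
    rw [geomGrid_odd_add_one ht0.ne', geomGrid_odd]
    have : 0 < t ^ k * (lam * t + 1) := by positivity
    linarith [hbound k (by linarith [hx.1, dotB_pos])]

theorem tendsto_geomGrid_atTop (hlam : 1 < lam) (ht : 1 < t) :
    Tendsto (geomGrid lam t) atTop atTop := by
  have hpow : Tendsto (fun k : ℤ => t ^ k) atTop atTop := by
    simpa only [Function.comp_def, Real.rpow_intCast] using
      (tendsto_rpow_atTop_of_base_gt_one t ht).comp tendsto_intCast_atTop_atTop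
  exact interleave_tendsto_atTop (hpow.atTop_mul_const (by linarith))
    (hpow.atTop_mul_const (by nlinarith))

theorem tendsto_geomGrid_atBot (lam : ℝ) (ht : 1 < t) : Tendsto (geomGrid lam t) atBot (𝓝 0) := by
  have hcast : Tendsto (Int.cast : ℤ → ℝ) atBot atBot := tendsto_intCast_atBot_iff.2 tendsto_id
  have hpow : Tendsto (fun k : ℤ => t ^ k) atBot (𝓝 0) := by
    simpa only [Function.comp_def, Real.rpow_intCast] using
      (tendsto_rpow_atBot_of_base_gt_one t ht).comp hcast
  exact interleave_tendsto_atBot (by simpa using hpow.mul_const (lam + t))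
    (by simpa using hpow.mul_const (lam * t + 1))

end GeomGrid

/-! ### Models of constant slope -/

section Models

variable {lam : ℝ}

theorem exists_hasSlopeAlong_tendsto_zero (h : 2 + √5 < lam) :
    ∃ φ, Continuous φ ∧ StrictMono φ ∧ HasSlopeAlong dot mapF φ lam ∧
      Tendsto (fun j => φ (dot j)) atBot (𝓝 0) ∧ Tendsto (fun j => φ (dot j)) atTop atTop := by
  have hlam : 1 < lam := by linarith [two_lt_sqrt_five]
  obtain ⟨t, ht, htlam, hteq⟩ := exists_geomGrid_ratio h
  have ht0 : 0 < t := by linarith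
  have hweight : ∀ x, t * (lam + t) * t ^ mapF x ≤ t * (t * (lam + t) * t ^ x) := fun x =>
    calc t * (lam + t) * t ^ mapF x ≤ t * (lam + t) * t ^ (x + 1) := by
          gcongr
          exacts [ht.le, mapF_le_add_one x]
      _ = t * (t * (lam + t) * t ^ x) := by
          rw [Real.rpow_add_one ht0.ne']
          ring
  obtain ⟨φ, hcont, hφ, hφdot, hs⟩ :=
    (isSlopeGrid_geomGrid hlam ht hteq).exists_strictMono_hasSlopeAlong dot_add_one_sub_le_one
      (by linarith [two_lt_sqrt_five] : 2 < 2 + √5)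
      (fun j x hx y hy => (abs_mapF_sub_mapF j x hx y hy).ge) isMarkovMap_mapF
      ((Real.continuous_const_rpow ht0.ne').const_mul _) hweight ht0.le htlam
      fun _ _ hx => geomGrid_add_one_sub_le hlam ht hx
  exact ⟨φ, hcont, hφ, hs, (tendsto_geomGrid_atBot lam ht).congr fun j => (hφdot j).symm,
    (tendsto_geomGrid_atTop hlam ht).congr fun j => (hφdot j).symm⟩

theorem mapsTo_dotB_sub_piece (j : ℤ) : MapsTo (dotB - ·) (piece dot j) (piece dot (-j)) := by
  have hleft := dotB_sub_dot (j + 1)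
  have hright := dotB_sub_dot j
  rw [show 1 - (j + 1) = -j by ring] at hleft
  rw [show 1 - j = -j + 1 by ring] at hright
  intro x hx
  constructor <;> linarith [hx.1, hx.2]

theorem HasSlopeAlong.neg_comp_dotB_sub {φ : ℝ → ℝ} (hs : HasSlopeAlong dot mapF φ lam) :
    HasSlopeAlong dot mapF (fun x => -φ (dotB - x)) lam :=
  hs.neg_comp (fun x => (mapF_dotB_sub x).symm) fun j => ⟨-j, mapsTo_dotB_sub_piece j⟩

theorem strictMono_neg_comp_dotB_sub {φ : ℝ → ℝ} (hφ : StrictMono φ) :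
    StrictMono fun x => -φ (dotB - x) := fun _ _ hxy => neg_lt_neg (hφ (sub_lt_sub_left hxy _))

theorem tendsto_one_sub_atTop : Tendsto (fun j : ℤ => 1 - j) atTop atBot :=
  tendsto_atBot_add_const_left _ 1 tendsto_neg_atTop_atBot

theorem tendsto_one_sub_atBot : Tendsto (fun j : ℤ => 1 - j) atBot atTop :=
  tendsto_atTop_add_const_left _ 1 tendsto_neg_atBot_atTop

/-- For `lam > 2 + √5` the model is the sum of a model on `(0, ∞)` and its mirror image. -/
theorem exists_hasSlopeAlong_tendsto_atTop (h : 2 + √5 ≤ lam) :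
    ∃ φ, Continuous φ ∧ StrictMono φ ∧ HasSlopeAlong dot mapF φ lam ∧
      Tendsto (fun j => φ (dot j)) atBot atBot ∧ Tendsto (fun j => φ (dot j)) atTop atTop := by
  rcases h.eq_or_lt with rfl | h
  · exact ⟨id, continuous_id, strictMono_id, hasSlopeAlong_id_mapF, isGrid_dot.tendsto_atBot,
      isGrid_dot.tendsto_atTop⟩
  obtain ⟨φ, hcont, hφ, hs, hbot, htop⟩ := exists_hasSlopeAlong_tendsto_zero h
  have hφ' := strictMono_neg_comp_dotB_sub hφ
  refine ⟨fun x => φ x + -φ (dotB - x), by fun_prop, hφ.add hφ',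
    hs.add hs.neg_comp_dotB_sub isMarkovMap_mapF hφ hφ', ?_, ?_⟩
  · simp only [dotB_sub_dot]
    exact hbot.add_atBot (tendsto_neg_atTop_atBot.comp (htop.comp tendsto_one_sub_atBot))
  · simp only [dotB_sub_dot]
    exact htop.atTop_add (hbot.comp tendsto_one_sub_atTop).neg

section Extension

variable {X : Type*} [LinearOrder X] [TopologicalSpace X] [OrderTopology X]

theorem isConjugateToConstantSlope_bot_top (e : EReal ≃o X) (h : 2 + √5 ≤ lam) :
    IsConjugateToConstantSlope (extension e mapF) ⊥ ⊤ lam := by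
  obtain ⟨φ, hcont, hφ, hs, hbot, htop⟩ := exists_hasSlopeAlong_tendsto_atTop h
  exact isConjugateToConstantSlope_extension e isMarkovMap_mapF tendsto_mapF_atBot
    tendsto_mapF_atTop hφ hcont hs (EReal.tendsto_coe_nhds_bot_iff.2 hbot)
    (EReal.tendsto_coe_nhds_top_iff.2 htop)

theorem isConjugateToConstantSlope_coe_top (e : EReal ≃o X) (h : 2 + √5 < lam) (a : ℝ) :
    IsConjugateToConstantSlope (extension e mapF) a ⊤ lam := by
  obtain ⟨φ, hcont, hφ, hs, hbot, htop⟩ := exists_hasSlopeAlong_tendsto_zero h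
  refine isConjugateToConstantSlope_extension e isMarkovMap_mapF tendsto_mapF_atBot
    tendsto_mapF_atTop (hφ.add_const a) (by fun_prop) (hs.add_const a) ?_ ?_
  · have hlim := hbot.add_const a
    rw [zero_add] at hlim
    exact (continuous_coe_real_ereal.tendsto _).comp hlim
  · exact EReal.tendsto_coe_nhds_top_iff.2 (tendsto_atTop_add_const_right _ a htop)

theorem isConjugateToConstantSlope_bot_coe (e : EReal ≃o X) (h : 2 + √5 < lam) (a : ℝ) :
    IsConjugateToConstantSlope (extension e mapF) ⊥ a lam := by
  obtain ⟨φ, hcont, hφ, hs, hbot, htop⟩ := exists_hasSlopeAlong_tendsto_zero h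
  refine isConjugateToConstantSlope_extension e isMarkovMap_mapF tendsto_mapF_atBot
    tendsto_mapF_atTop ((strictMono_neg_comp_dotB_sub hφ).add_const a) (by fun_prop)
    (hs.neg_comp_dotB_sub.add_const a) ?_ ?_
  · simp only [dotB_sub_dot]
    exact EReal.tendsto_coe_nhds_bot_iff.2 (tendsto_atBot_add_const_right _ a
      (tendsto_neg_atTop_atBot.comp (htop.comp tendsto_one_sub_atBot)))
  · simp only [dotB_sub_dot]
    have hlim := (hbot.comp tendsto_one_sub_atTop).neg.add_const a
    rw [neg_zero, zero_add] at hlim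
    exact (continuous_coe_real_ereal.tendsto _).comp hlim

end Extension

end Models

/-! ### Eigenvectors -/

section TransitionMatrix

variable {X : Type*} [LinearOrder X] [TopologicalSpace X] [OrderTopology X]
variable {d : ℤ → ℝ} {τ : ℤ → ℤ} {G φ : ℝ → ℝ} {lam : ℝ}

/-- The enumeration, along the grid `d`, of the basic intervals of the extended grid. -/
noncomputable def cellEquiv (e : EReal ≃o X) (hd : IsGrid d) :
    ℤ ≃ basicIntervals (extendedGrid e d) :=
  (Equiv.ofInjective (cell e d) fun i j hij => by
    by_contra hne
    have hdisj : Disjoint (cell e d i) (cell e d j) := disjoint_cell e hd hne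
    rw [hij, disjoint_self] at hdisj
    exact (cell_nonempty e hd j).ne_empty hdisj).trans
  (Equiv.setCongr (basicIntervals_extendedGrid e hd).symm)

theorem transitionMatrix_cellEquiv (e : EReal ≃o X) (hG : IsMarkovMap d τ G) (i j : ℤ) :
    transitionMatrix (extension e G) (extendedGrid e d)
      (cellEquiv e hG.isGrid i) (cellEquiv e hG.isGrid j) =
      if j ∈ coveredPieces τ i then 1 else 0 := by
  classical
  exact if_congr (cell_subset_image_iff hG) rfl rfl

theorem hasSum_transitionMatrix_mul (e : EReal ≃o X) (hG : IsMarkovMap d τ G)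
    (v : basicIntervals (extendedGrid e d) → ℝ) (i : ℤ) :
    HasSum (fun J => transitionMatrix (extension e G) (extendedGrid e d)
      (cellEquiv e hG.isGrid i) J * v J)
      (∑ j ∈ coveredPieces τ i, v (cellEquiv e hG.isGrid j)) := by
  rw [← (cellEquiv e hG.isGrid).hasSum_iff, ← Finset.sum_congr rfl fun j hj => if_pos hj]
  convert hasSum_sum_of_ne_finset_zero (L := .unconditional ℤ) (s := coveredPieces τ i)
    (f := fun j => if j ∈ coveredPieces τ i then v (cellEquiv e hG.isGrid j) else 0)
    (fun j hj => if_neg hj) using 2 with j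
  rw [Function.comp_apply, transitionMatrix_cellEquiv e hG, ite_mul, one_mul, zero_mul]

theorem isNonnegEigenvector_iff (e : EReal ≃o X) (hG : IsMarkovMap d τ G)
    {v : basicIntervals (extendedGrid e d) → ℝ} :
    IsNonnegEigenvector (transitionMatrix (extension e G) (extendedGrid e d)) lam v ↔
      v ∘ cellEquiv e hG.isGrid ≠ 0 ∧ (∀ i, 0 ≤ v (cellEquiv e hG.isGrid i)) ∧
        ∀ i, ∑ j ∈ coveredPieces τ i, v (cellEquiv e hG.isGrid j) =
          lam * v (cellEquiv e hG.isGrid i) := by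
  have hsum := hasSum_transitionMatrix_mul e hG v
  have hsurj := (cellEquiv e hG.isGrid).surjective
  constructor
  · exact fun hv => ⟨fun h => hv.ne_zero (hsurj.injective_comp_right h), fun i => hv.nonneg _,
      fun i => (hsum i).unique (hv.eigen _)⟩
  · rintro ⟨hne, hnonneg, heig⟩
    exact ⟨fun h => hne (by rw [h]; rfl), hsurj.forall.2 hnonneg,
      hsurj.forall.2 fun i => heig i ▸ hsum i⟩

theorem HasSlopeAlong.exists_isNonnegEigenvector (hs : HasSlopeAlong d G φ lam) (e : EReal ≃o X)
    (hG : IsMarkovMap d τ G) (hφ : StrictMono φ) :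
    ∃ v, IsNonnegEigenvector (transitionMatrix (extension e G) (extendedGrid e d)) lam v := by
  let increment (j : ℤ) : ℝ := φ (d (j + 1)) - φ (d j)
  have hpos (j : ℤ) : 0 < increment j := sub_pos.2 (hφ (hG.isGrid.lt_succ j))
  refine ⟨increment ∘ (cellEquiv e hG.isGrid).symm, (isNonnegEigenvector_iff e hG).2 ?_⟩
  simp only [Function.comp_assoc, Function.comp_apply, Equiv.symm_comp_self, Function.comp_id,
    Equiv.symm_apply_apply]
  exact ⟨fun h => (hpos 0).ne' (congrFun h 0), fun i => (hpos i).le,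
    (hs.isSlopeGrid hG hφ).sum_coveredPieces⟩

end TransitionMatrix

section Recurrence

variable {x : ℤ → ℝ}

/-- The ratios of consecutive terms decrease by at least `2 - s` at each step, because
`r + r⁻¹ ≥ 2`; they would become negative. -/
theorem two_le_of_pos_of_recurrence {s : ℝ} (hx : ∀ k, 0 < x k)
    (hrec : ∀ k, x (k + 1) + x (k - 1) = s * x k) : 2 ≤ s := by
  by_contra! hlt
  have hstep (k : ℤ) : x (k + 1) / x k ≤ x k / x (k - 1) - (2 - s) := by
    have hk := hx k
    have hpred := hx (k - 1)
    have htwo : 2 ≤ x k / x (k - 1) + x (k - 1) / x k := by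
      rw [div_add_div _ _ hpred.ne' hk.ne', le_div_iff₀ (by positivity)]
      nlinarith [sq_nonneg (x k - x (k - 1))]
    rw [eq_sub_of_add_eq (hrec k), sub_div, mul_div_cancel_right₀ _ hk.ne']
    linarith
  have hiter (n : ℕ) : x (n + 1) / x n ≤ x 1 / x 0 - n * (2 - s) := by
    induction n with
    | zero => simp
    | succ n ih =>
      have hn := hstep (n + 1)
      rw [add_sub_cancel_right] at hn
      push_cast
      linarith
  obtain ⟨n, hn⟩ := exists_nat_gt (x 1 / x 0 / (2 - s))
  rw [div_lt_iff₀ (by linarith)] at hn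
  linarith [hiter n, div_pos (hx (n + 1)) (hx n)]

theorem exists_injective_le_of_convex (hconv : ∀ k, 2 * x k ≤ x (k + 1) + x (k - 1)) :
    ∃ σ : ℕ → ℤ, Function.Injective σ ∧ ∀ n, x 0 ≤ x (σ n) := by
  have hmono : Monotone fun k => x (k + 1) - x k := monotone_int_of_le_succ fun k => by
    have hk := hconv (k + 1)
    rw [add_sub_cancel_right] at hk
    linarith
  rcases le_total 0 (x (0 + 1) - x 0) with hinc | hdec
  · refine ⟨fun n => n, Nat.cast_injective, fun n => ?_⟩
    induction n with
    | zero => rfl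
    | succ n ih =>
      have hn := hinc.trans (hmono n.cast_nonneg)
      push_cast
      linarith
  · refine ⟨fun n => -n, neg_injective.comp Nat.cast_injective, fun n => ?_⟩
    induction n with
    | zero => rfl
    | succ n ih =>
      have hn := (hmono (show -(n : ℤ) - 1 ≤ 0 by omega)).trans hdec
      beta_reduce at hn ih ⊢
      rw [sub_add_cancel] at hn
      rw [Nat.cast_succ, neg_add']
      linarith

theorem not_summable_of_convex (hx : 0 < x 0) (hconv : ∀ k, 2 * x k ≤ x (k + 1) + x (k - 1)) :
    ¬Summable x := by
  intro hsum
  obtain ⟨σ, hσ, hle⟩ := exists_injective_le_of_convex hconv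
  exact hx.not_ge (ge_of_tendsto' (hsum.comp_injective hσ).tendsto_atTop_zero hle)

end Recurrence

theorem sum_coveredPieces_dotMap_even (u : ℤ → ℝ) (k : ℤ) :
    ∑ j ∈ coveredPieces dotMap (2 * k), u j =
      u (2 * (k - 1)) + u (2 * (k - 1) + 1) + u (2 * k) + u (2 * k + 1) + u (2 * (k + 1)) := by
  have hpieces : coveredPieces dotMap (2 * k) =
      {2 * (k - 1), 2 * (k - 1) + 1, 2 * k, 2 * k + 1, 2 * (k + 1)} := by
    ext j
    simp only [coveredPieces, dotMap_even, dotMap_odd, Finset.mem_Ico, Finset.mem_insert,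
      Finset.mem_singleton]
    omega
  rw [hpieces]
  repeat rw [Finset.sum_insert (by simp <;> omega)]
  rw [Finset.sum_singleton]
  ring

theorem sum_coveredPieces_dotMap_odd (u : ℤ → ℝ) (k : ℤ) :
    ∑ j ∈ coveredPieces dotMap (2 * k + 1), u j = u (2 * k) + u (2 * k + 1) + u (2 * (k + 1)) := by
  have hpieces : coveredPieces dotMap (2 * k + 1) = {2 * k, 2 * k + 1, 2 * (k + 1)} := by
    ext j
    rw [coveredPieces, show 2 * k + 1 + 1 = 2 * (k + 1) by ring]
    simp only [dotMap_even, dotMap_odd, Finset.mem_Ico, Finset.mem_insert, Finset.mem_singleton]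
    omega
  rw [hpieces]
  repeat rw [Finset.sum_insert (by simp <;> omega)]
  rw [Finset.sum_singleton]
  ring

section NonnegSolutions

variable {lam : ℝ} {u : ℤ → ℝ} (heig : ∀ i, ∑ j ∈ coveredPieces dotMap i, u j = lam * u i)

include heig

theorem even_recurrence_of_eigen (k : ℤ) :
    lam * (u (2 * (k + 1)) + u (2 * (k - 1))) = (lam * lam - 2 * lam - 1) * u (2 * k) := by
  have heven := heig (2 * k)
  have hodd := heig (2 * k + 1)
  have hodd' := heig (2 * (k - 1) + 1)
  rw [sum_coveredPieces_dotMap_even] at heven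
  rw [sum_coveredPieces_dotMap_odd] at hodd hodd'
  rw [sub_add_cancel] at hodd'
  linear_combination (lam - 1) * heven + hodd + hodd'

variable (hu : ∀ i, 0 ≤ u i)

include hu

theorem exists_pos_even_of_eigen (hne : u ≠ 0) : ∃ k, 0 < u (2 * k) := by
  by_contra! hle
  have hzero (k : ℤ) : u (2 * k) = 0 := (hle k).antisymm (hu _)
  refine hne (funext fun i => ?_)
  obtain ⟨k, rfl | rfl⟩ := Int.even_or_odd' i
  · exact hzero k
  · have heven := heig (2 * k)
    rw [sum_coveredPieces_dotMap_even, hzero, hzero, hzero] at heven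
    have hle : u (2 * k + 1) ≤ 0 := by linarith [hu (2 * (k - 1) + 1)]
    exact hle.antisymm (hu _)

theorem eigenvalue_pos (hne : u ≠ 0) : 0 < lam := by
  obtain ⟨k, hk⟩ := exists_pos_even_of_eigen heig hu hne
  refine pos_of_mul_pos_left (b := u (2 * k)) ?_ hk.le
  rw [← heig, sum_coveredPieces_dotMap_even]
  linarith [hu (2 * (k - 1)), hu (2 * (k - 1) + 1), hu (2 * k + 1), hu (2 * (k + 1))]

theorem pos_even_of_eigen (hne : u ≠ 0) (k : ℤ) : 0 < u (2 * k) := by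
  have hlam := eigenvalue_pos heig hu hne
  have hneighbour {k : ℤ} (hk : 0 < u (2 * (k - 1)) ∨ 0 < u (2 * (k + 1))) : 0 < u (2 * k) := by
    refine pos_of_mul_pos_right (a := lam) ?_ hlam.le
    rw [← heig, sum_coveredPieces_dotMap_even]
    rcases hk with hk | hk <;> linarith [hu (2 * (k - 1)), hu (2 * (k - 1) + 1), hu (2 * k),
      hu (2 * k + 1), hu (2 * (k + 1))]
  obtain ⟨k₀, hk₀⟩ := exists_pos_even_of_eigen heig hu hne
  exact Int.inductionOn' k k₀ hk₀
    (fun k _ ih => hneighbour (.inl (by rwa [add_sub_cancel_right])))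
    (fun k _ ih => hneighbour (.inr (by rwa [sub_add_cancel])))

theorem two_add_sqrt_five_le_of_eigen (hne : u ≠ 0) : 2 + √5 ≤ lam := by
  have hlam := eigenvalue_pos heig hu hne
  rw [← two_mul_le_iff_two_add_sqrt_five_le hlam, ← le_div_iff₀ hlam]
  refine two_le_of_pos_of_recurrence (pos_even_of_eigen heig hu hne) fun k => ?_
  rw [div_mul_eq_mul_div, ← even_recurrence_of_eigen heig, mul_div_cancel_left₀ _ hlam.ne']

theorem not_summable_of_eigen (hne : u ≠ 0) : ¬Summable u := by
  have hlam := eigenvalue_pos heig hu hne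
  have hpos := pos_even_of_eigen heig hu hne
  have htwo := (two_mul_le_iff_two_add_sqrt_five_le hlam).2
    (two_add_sqrt_five_le_of_eigen heig hu hne)
  have hconv (k : ℤ) : 2 * u (2 * k) ≤ u (2 * (k + 1)) + u (2 * (k - 1)) := by
    refine le_of_mul_le_mul_left ?_ hlam
    rw [even_recurrence_of_eigen heig]
    nlinarith [hpos k]
  exact fun hsum => not_summable_of_convex (x := fun k => u (2 * k)) (hpos 0) hconv
    (hsum.comp_injective (mul_right_injective₀ (two_ne_zero (α := ℤ))))

end NonnegSolutions

section Eigenvectors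

variable {X : Type*} [LinearOrder X] [TopologicalSpace X] [OrderTopology X]

theorem exists_isNonnegEigenvector_iff (e : EReal ≃o X) (lam : ℝ) :
    (∃ v, IsNonnegEigenvector (transitionMatrix (extension e mapF) (extendedGrid e dot)) lam v) ↔
      2 + √5 ≤ lam := by
  constructor
  · rintro ⟨v, hv⟩
    obtain ⟨hne, hnonneg, heig⟩ := (isNonnegEigenvector_iff e isMarkovMap_mapF).1 hv
    exact two_add_sqrt_five_le_of_eigen heig hnonneg hne
  · intro hlam
    obtain ⟨φ, -, hφ, hs, -⟩ := exists_hasSlopeAlong_tendsto_atTop hlam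
    exact hs.exists_isNonnegEigenvector e isMarkovMap_mapF hφ

theorem not_summable_of_isNonnegEigenvector {e : EReal ≃o X} {lam : ℝ}
    {v : basicIntervals (extendedGrid e dot) → ℝ}
    (hv : IsNonnegEigenvector (transitionMatrix (extension e mapF) (extendedGrid e dot)) lam v) :
    ¬Summable v := by
  obtain ⟨hne, hnonneg, heig⟩ := (isNonnegEigenvector_iff e isMarkovMap_mapF).1 hv
  rw [← (cellEquiv e isGrid_dot).summable_iff]
  exact not_summable_of_eigen heig hnonneg hne

end Eigenvectors

end ConstantSlope

theorem mainTheorem5 :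
    -- `F` has constant slope `2 + √5` on each interval between consecutive dots
    (∀ k : ℤ,
      (∀ x ∈ Set.Icc (k : ℝ) (k + ConstantSlope.dotB),
        ConstantSlope.mapF x = k - 1 + (2 + √5) * (x - k)) ∧
      (∀ x ∈ Set.Icc ((k : ℝ) + ConstantSlope.dotB) (k + 1),
        ConstantSlope.mapF x =
          k + ConstantSlope.dotB + 1 - (2 + √5) * (x - (k + ConstantSlope.dotB)))) ∧
    ∀ h : Set.Ioo (0 : ℝ) 1 ≃ₜ ℝ,
      ConstantSlope.IsCPMM (ConstantSlope.mapf h) (ConstantSlope.partitionP h) ∧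
      ConstantSlope.IsTopologicallyMixing (ConstantSlope.mapf h) ∧
      (∀ lam : ℝ,
        (∃ v, ConstantSlope.IsNonnegEigenvector
          (ConstantSlope.transitionMatrix (ConstantSlope.mapf h) (ConstantSlope.partitionP h))
          lam v) ↔ 2 + √5 ≤ lam) ∧
      (∀ (lam : ℝ) (v : ConstantSlope.basicIntervals (ConstantSlope.partitionP h) → ℝ),
        ConstantSlope.IsNonnegEigenvector
          (ConstantSlope.transitionMatrix (ConstantSlope.mapf h) (ConstantSlope.partitionP h))
          lam v → ¬ Summable v) ∧
      (∀ lam : ℝ, 2 + √5 ≤ lam →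
        ConstantSlope.IsConjugateToConstantSlope (ConstantSlope.mapf h) ⊥ ⊤ lam) ∧
      (∀ lam : ℝ, 2 + √5 < lam → ∀ a : ℝ,
        ConstantSlope.IsConjugateToConstantSlope (ConstantSlope.mapf h) (a : EReal) ⊤ lam ∧
        ConstantSlope.IsConjugateToConstantSlope (ConstantSlope.mapf h) ⊥ (a : EReal) lam) := by
  refine ⟨fun k => ⟨fun x hx => ConstantSlope.mapF_left hx,
    fun x hx => ConstantSlope.mapF_right hx⟩, fun h => ?_⟩
  obtain ⟨e, hf, hP⟩ := ConstantSlope.exists_orderIso_mapf h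
  rw [hf, hP]
  exact ⟨ConstantSlope.isCPMM_extension e ConstantSlope.isMarkovMap_mapF
      ConstantSlope.tendsto_mapF_atBot ConstantSlope.tendsto_mapF_atTop,
    ConstantSlope.isTopologicallyMixing_extension e ConstantSlope.isTopologicallyMixing_mapF,
    ConstantSlope.exists_isNonnegEigenvector_iff e,
    fun _ _ => ConstantSlope.not_summable_of_isNonnegEigenvector,
    fun _ hlam => ConstantSlope.isConjugateToConstantSlope_bot_top e hlam,
    fun _ hlam a => ⟨ConstantSlope.isConjugateToConstantSlope_coe_top e hlam a,
      ConstantSlope.isConjugateToConstantSlope_bot_coe e hlam a⟩⟩
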